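/- Let $l:(0,\infty)\to[0,1]$ be positive, monotone increasing and slowly varying at $0$ (i.e. $l(cx)/l(x)\to1$ as $x\downarrow0$ for every $c>0$), with $\lim_{u\downarrow 0}l(u)=0$, and put $$\alpha(p)=\frac1{p^2}\int_0^p\int_0^v l(u)\,du\,dv ,\qquad p\in(0,1].$$ There is a constant $C>0$, depending only on $l$, such that the following holds. Consider a bandit with a finite set $\mathcal A$ of $N\ge2$ arms and independent Bernoulli rewards $R_a(t)\in\{0,1\}$, $t=0,1,2,\dots$, with means $r_a\in[0,1]$, a unique optimal arm $a^\star$, $r^\star=r_{a^\star}$, and gap $\Delta=r^\star-\max_{a\ne a^\star}r_a>0$. Run SAMBA with learning rate $\alpha(\cdot)$ from any $p(0)$ with $p_a(0)>0$ and $\sum_ap_a(0)=1$: at each time $t$, let $a_\star(t)$ be an arm maximizing $p_a(t)$ (ties are broken uniformly at random) and, independently of the tie-breaking given the past, play arm $a$ with probability $p_a(t)$, writing $I_a(t)$ for the indicator that arm $a$ is played; then for $a\neq a_\star(t)$ set $$p_a(t+1)=p_a(t)+\alpha(p_a(t))\,p_a(t)^2\left[\frac{I_a(t)R_a(t)}{p_a(t)}-\frac{I_{a_\star(t)}(t)R_{a_\star(t)}(t)}{p_{a_\star(t)}(t)}\right],$$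 and $p_{a_\star(t)}(t+1)=1-\sum_{a\neq a_\star(t)}p_a(t+1)$. Then the process $(p_a(t):a\in\mathcal A)$, $t=0,1,2,\dots$, is a (time-homogeneous) Markov chain; with probability $1$, $p_{a^\star}(t)\to1$ as $t\to\infty$; the quantity $Q:=\sum_{t=0}^\infty\mathbb P\big(p_{a^\star}(t)\le\tfrac12\big)$ is finite; and for every integer $T\ge1$ the regret satisfies $$r^\star T-\mathbb E\Big[\sum_{t=0}^{T-1}\sum_{a\in\mathcal A}I_a(t)R_a(t)\Big]\;\le\;\frac{CN}{\Delta\,l\!\left(\frac{C}{\Delta T}\right)}\log T+Q+1 .$$ -/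

import Mathlib

open MeasureTheory ProbabilityTheory Filter Topology

/-- A function on `(0, ∞)` that is positive and slowly varying at `0`. -/
def SlowlyVaryingAtZero (l : ℝ → ℝ) : Prop :=
  (∀ u, 0 < u → 0 < l u) ∧
    ∀ c, 0 < c → Tendsto (fun x => l (c * x) / l x) (𝓝[>] 0) (𝓝 1)

/-- The learning rate `α(p) = p⁻² ∫₀ᵖ ∫₀ᵛ l(u) du dv`. -/
noncomputable def learningRate (l : ℝ → ℝ) (p : ℝ) : ℝ :=
  1 / p ^ 2 * ∫ v in (0 : ℝ)..p, ∫ u in (0 : ℝ)..v, l u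

/-- `X` is a time-homogeneous Markov chain (with respect to its own filtration). -/
def IsMarkovChain {Ω E : Type*} [MeasurableSpace Ω] [MeasurableSpace E]
    (μ : Measure Ω) (X : ℕ → Ω → E) : Prop :=
  (∀ t, Measurable (X t)) ∧
    ∃ κ : Kernel E E, IsMarkovKernel κ ∧
      ∀ (t : ℕ) (S : Set E), MeasurableSet S →
        μ[(X (t + 1) ⁻¹' S).indicator (fun _ => (1 : ℝ)) |
            ⨆ s ∈ Set.Iic t, MeasurableSpace.comap (X s) inferInstance]
          =ᵐ[μ] fun ω => (κ (X t ω)).real S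

section Bandit

variable {A Ω : Type*} [Fintype A] [DecidableEq A]

/-- The gap between the mean reward of the best arm and that of the next best arm. -/
noncomputable def gap (r : A → ℝ) (aStar : A) : ℝ :=
  r aStar - ⨆ a : {a : A // a ≠ aStar}, r a

/-- The set of arms of maximal probability. -/
noncomputable def maximizers (q : A → ℝ) : Finset A :=
  Finset.univ.filter fun a => ∀ b, q b ≤ q a

/-- `I_a(t)`: the indicator that arm `a` is played at time `t`. -/
def played (arm : ℕ → Ω → A) (a : A) (t : ℕ) (ω : Ω) : ℝ :=
  if arm t ω = a then 1 else 0

/-- One SAMBA update of the probability vector `q`, where `lead` is the leading arm and `y a` is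
the observation `I_a R_a`. -/
noncomputable def sambaUpdate (α : ℝ → ℝ) (q : A → ℝ) (lead : A) (y : A → ℝ) : A → ℝ :=
  let new : A → ℝ := fun a => q a + α (q a) * q a ^ 2 * (y a / q a - y lead / q lead)
  fun a => if a = lead then 1 - ∑ b ∈ Finset.univ.erase lead, new b else new a

/-- The information available just before time `t`: the leading arms, the arms played and the
observed rewards at all times `s < t`. -/
abbrev history [MeasurableSpace A] (R : ℕ → A → Ω → ℝ) (arm lead : ℕ → Ω → A) (t : ℕ) :
    MeasurableSpace Ω :=
  ⨆ s ∈ Set.Iio t,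
    (MeasurableSpace.comap (lead s) inferInstance ⊔ MeasurableSpace.comap (arm s) inferInstance ⊔
      MeasurableSpace.comap (fun ω a => played arm a s ω * R s a ω) inferInstance)

/-- `p` is the SAMBA process with learning rate `α` started at `p0`, in the bandit with Bernoulli
rewards `R t a` of mean `r a`; `arm t` is the arm played at time `t` and `lead t` is the leading
arm, ties being broken uniformly at random. -/
structure IsSamba [MeasurableSpace A] [MeasurableSpace Ω] (μ : Measure Ω)
    (r : A → ℝ) (α : ℝ → ℝ) (p0 : A → ℝ)
    (R : ℕ → A → Ω → ℝ) (arm lead : ℕ → Ω → A) (p : ℕ → Ω → A → ℝ) : Prop where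
  measurable_reward : ∀ t a, Measurable (R t a)
  measurable_arm : ∀ t, Measurable (arm t)
  measurable_lead : ∀ t, Measurable (lead t)
  /-- rewards are Bernoulli with mean `r a`, independent over times and arms -/
  reward_values : ∀ t a ω, R t a ω = 0 ∨ R t a ω = 1
  reward_law : ∀ t a, μ.real {ω | R t a ω = 1} = r a
  reward_indep : iIndepFun (fun (x : ℕ × A) => R x.1 x.2) μ
  /-- the choices at time `t` do not look at the rewards of time `t` -/
  reward_indep_choice : ∀ t,
    Indep (MeasurableSpace.comap (fun ω a => R t a ω) inferInstance)
      (history R arm lead t ⊔ MeasurableSpace.comap (lead t) inferInstance ⊔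
        MeasurableSpace.comap (arm t) inferInstance) μ
  /-- the leading arm is uniform on the set of maximizing arms, given the past -/
  lead_mem : ∀ t ω, lead t ω ∈ maximizers (p t ω)
  lead_law : ∀ t a,
    μ[fun ω => if lead t ω = a then (1 : ℝ) else 0 | history R arm lead t]
      =ᵐ[μ] fun ω => if a ∈ maximizers (p t ω) then 1 / ((maximizers (p t ω)).card : ℝ) else 0
  /-- arm `a` is played with probability `p_a(t)`, given the past and the leading arm -/
  arm_law : ∀ t a,
    μ[played arm a t |
        history R arm lead t ⊔ MeasurableSpace.comap (lead t) inferInstance]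
      =ᵐ[μ] fun ω => p t ω a
  init : ∀ ω, p 0 ω = p0
  step : ∀ t ω,
    p (t + 1) ω = sambaUpdate α (p t ω) (lead t ω) (fun a => played arm a t ω * R t a ω)

/-- The regret at time `T`: `r⋆ T - E[∑_{t<T} ∑_a I_a(t) R_a(t)]`. -/
noncomputable def regret [MeasurableSpace Ω] (μ : Measure Ω) (r : A → ℝ) (aStar : A)
    (R : ℕ → A → Ω → ℝ) (arm : ℕ → Ω → A) (T : ℕ) : ℝ :=
  r aStar * T - ∫ ω, ∑ t ∈ Finset.range T, ∑ a, played arm a t ω * R t a ω ∂μ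

end Bandit

/-! Write `s` for the best arm, `q` for the state, `n = N - 1`. Monotonicity of `l` gives `l (p/2) /
8 ≤ α p ≤ l p / 2`, and slow variation gives `α x ≥ k x` on `(0,1]`. So `α` lies in `(0, 1/2]`,
tends to `0` at `0`, but not faster than linearly. The importance weights make the mean increment of
`q s` equal to `α(q s) (q s)² (r s - r lead)` when `s` trails and `∑ α(q a) (q a)² (r s - r a)` when
it leads; both are nonnegative.

Convergence and finiteness of `Q` come from the Lyapunov function `(q s)⁻² + K (1 - q s)`
(`exists_lyapunov`). When `q s` is small, the first-order drift of `(q s)⁻²` is at most `-2Δ α(q s)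
/ q s`, bounded away from `0` because `α x ≥ k x`, and it beats the second-order term because `α` is
small there. Elsewhere the second-order term is absorbed by the linear part. The drift is at most
`-c` on `{q s ≤ 1 - ε}`, so the probabilities of these events are summable in time, and
Borel–Cantelli gives `p s → 1`.

The regret is at most `∑ E(1 - p s)`. Once `q s > 1/2` the best arm leads, and with `z = 1 - q s`
the potential `log (z + δ)` decreases in mean by about `Δ m z / n`, where `m` bounds `α` below on
`[δ/n, 1]` (`sub_le_neg_sambaDrift_log`). It can fall by at most `log (1 + 1/δ)` in all, so the
regret is at most `Q + n/(Δ m) log (1 + 1/δ) + 3δT`. Taking `δ` of order `n/(ΔT)` balances the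
terms, and slow variation changes the argument of `l` at the cost of a constant. -/

/-! ### Bounds on the learning rate and consequences of slow variation. -/

theorem MonotoneOn.intervalIntegrable_of_bounded {l : ℝ → ℝ}
    (hrange : ∀ u, 0 < u → l u ∈ Set.Icc (0 : ℝ) 1) (hmono : MonotoneOn l (Set.Ioi 0))
    {a b : ℝ} (ha : 0 ≤ a) (hab : a ≤ b) : IntervalIntegrable l volume a b := by
  rw [intervalIntegrable_iff_integrableOn_Ioc_of_le hab]
  have hsub : Set.Ioc a b ⊆ Set.Ioi 0 := fun x hx => lt_of_le_of_lt ha hx.1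
  have hm : AEStronglyMeasurable l (volume.restrict (Set.Ioc a b)) :=
    (aemeasurable_restrict_of_monotoneOn measurableSet_Ioc
      (hmono.mono hsub)).aestronglyMeasurable
  refine ⟨hm, HasFiniteIntegral.of_bounded (C := 1) ?_⟩
  refine (ae_restrict_iff' measurableSet_Ioc).2 (Eventually.of_forall fun x hx => ?_)
  have := hrange x (hsub hx)
  rw [Real.norm_eq_abs, abs_of_nonneg this.1]
  exact this.2

theorem intervalIntegral_nonneg_of_pos {l : ℝ → ℝ}
    (hrange : ∀ u, 0 < u → l u ∈ Set.Icc (0 : ℝ) 1) {a b : ℝ} (ha : 0 ≤ a) (hab : a ≤ b) :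
    0 ≤ ∫ u in a..b, l u := by
  rw [intervalIntegral.integral_of_le hab]
  exact setIntegral_nonneg measurableSet_Ioc fun u hu => (hrange u (ha.trans_lt hu.1)).1

theorem MonotoneOn.integral_le_mul {l : ℝ → ℝ}
    (hrange : ∀ u, 0 < u → l u ∈ Set.Icc (0 : ℝ) 1) (hmono : MonotoneOn l (Set.Ioi 0))
    {v p : ℝ} (hv : 0 ≤ v) (hp : 0 < p) (hvp : v ≤ p) : ∫ u in (0 : ℝ)..v, l u ≤ l p * v := by
  have h := intervalIntegral.integral_mono_on_of_le_Ioo hv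
    (hmono.intervalIntegrable_of_bounded hrange le_rfl hv)
    (intervalIntegrable_const (c := l p))
    (fun x hx => hmono (Set.mem_Ioi.2 hx.1) (Set.mem_Ioi.2 hp) (hx.2.le.trans hvp))
  simpa [mul_comm] using h

theorem MonotoneOn.mul_le_integral {l : ℝ → ℝ}
    (hrange : ∀ u, 0 < u → l u ∈ Set.Icc (0 : ℝ) 1) (hmono : MonotoneOn l (Set.Ioi 0))
    {w v : ℝ} (hw : 0 < w) (hwv : w ≤ v) : l w * (v - w) ≤ ∫ u in (0 : ℝ)..v, l u := by
  have h := intervalIntegral.integral_mono_on_of_le_Ioo hwv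
    (intervalIntegrable_const (c := l w))
    (hmono.intervalIntegrable_of_bounded hrange hw.le hwv)
    (fun x hx => hmono (Set.mem_Ioi.2 hw) (Set.mem_Ioi.2 (hw.trans hx.1)) hx.1.le)
  have h0 : 0 ≤ ∫ u in (0 : ℝ)..w, l u :=
    intervalIntegral_nonneg_of_pos hrange le_rfl hw.le
  rw [← intervalIntegral.integral_add_adjacent_intervals
    (hmono.intervalIntegrable_of_bounded hrange le_rfl hw.le)
    (hmono.intervalIntegrable_of_bounded hrange hw.le hwv)]
  have : l w * (v - w) = ∫ u in w..v, l w := by simp [mul_comm]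
  linarith

theorem MonotoneOn.intervalIntegrable_primitive {l : ℝ → ℝ}
    (hrange : ∀ u, 0 < u → l u ∈ Set.Icc (0 : ℝ) 1) (hmono : MonotoneOn l (Set.Ioi 0))
    {a b : ℝ} (ha : 0 ≤ a) (hab : a ≤ b) :
    IntervalIntegrable (fun v => ∫ u in (0 : ℝ)..v, l u) volume a b := by
  apply MonotoneOn.intervalIntegrable
  intro x hx y hy hxy
  rw [Set.uIcc_of_le hab] at hx hy
  have hx0 : 0 ≤ x := ha.trans hx.1
  have h0 : 0 ≤ ∫ u in x..y, l u :=
    intervalIntegral_nonneg_of_pos hrange hx0 hxy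
  have := intervalIntegral.integral_add_adjacent_intervals
    (hmono.intervalIntegrable_of_bounded hrange le_rfl hx0)
    (hmono.intervalIntegrable_of_bounded hrange hx0 hxy)
  simp only
  linarith

theorem learningRate_le {l : ℝ → ℝ}
    (hrange : ∀ u, 0 < u → l u ∈ Set.Icc (0 : ℝ) 1) (hmono : MonotoneOn l (Set.Ioi 0))
    {p : ℝ} (hp : 0 < p) : learningRate l p ≤ l p / 2 := by
  have h := intervalIntegral.integral_mono_on hp.le
    (hmono.intervalIntegrable_primitive hrange le_rfl hp.le)
    ((by fun_prop : Continuous fun v : ℝ => l p * v).intervalIntegrable (μ := volume) 0 p)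
    (fun v hv => hmono.integral_le_mul hrange hv.1 hp hv.2)
  have e : ∫ v in (0 : ℝ)..p, l p * v = l p * (p ^ 2 / 2) := by
    rw [intervalIntegral.integral_const_mul, integral_id]; ring
  rw [e] at h
  unfold learningRate
  rw [one_div, inv_mul_le_iff₀ (by positivity)]
  linarith

/-- Only `v ∈ [p/2, p]` is kept in the outer integral; there the inner integral is at least `l (p/2)
(v - p/2)`. -/
theorem le_learningRate {l : ℝ → ℝ}
    (hrange : ∀ u, 0 < u → l u ∈ Set.Icc (0 : ℝ) 1) (hmono : MonotoneOn l (Set.Ioi 0))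
    {p : ℝ} (hp : 0 < p) : l (p / 2) / 8 ≤ learningRate l p := by
  have hp2 : p / 2 ≤ p := by linarith
  have hp0 : 0 < p / 2 := by linarith
  have h := intervalIntegral.integral_mono_on hp2
    ((by fun_prop : Continuous fun v : ℝ => l (p / 2) * (v - p / 2)).intervalIntegrable
      (μ := volume) (p / 2) p)
    (hmono.intervalIntegrable_primitive hrange hp0.le hp2)
    (fun v hv => hmono.mul_le_integral hrange hp0 hv.1)
  have h0 : 0 ≤ ∫ v in (0 : ℝ)..(p / 2), ∫ u in (0 : ℝ)..v, l u :=
    intervalIntegral.integral_nonneg hp0.le fun v hv =>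
      intervalIntegral_nonneg_of_pos hrange le_rfl hv.1
  have e : ∫ v in (p / 2)..p, l (p / 2) * (v - p / 2) = l (p / 2) * (p ^ 2 / 8) := by
    rw [intervalIntegral.integral_const_mul, intervalIntegral.integral_sub
      (continuous_id'.intervalIntegrable _ _) (continuous_const.intervalIntegrable _ _)]
    rw [integral_id, intervalIntegral.integral_const, smul_eq_mul]
    ring
  rw [e] at h
  have hadd := intervalIntegral.integral_add_adjacent_intervals
    (hmono.intervalIntegrable_primitive hrange le_rfl hp0.le)
    (hmono.intervalIntegrable_primitive hrange hp0.le hp2)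
  unfold learningRate
  rw [one_div, le_inv_mul_iff₀ (by positivity)]
  linarith

/-- A monotone slowly varying function dominates a linear function near `0`. -/
theorem SlowlyVaryingAtZero.exists_mul_le {l : ℝ → ℝ} (hmono : MonotoneOn l (Set.Ioi 0))
    (hslow : SlowlyVaryingAtZero l) : ∃ k, 0 < k ∧ ∀ x, 0 < x → x ≤ 1 → k * x ≤ l x := by
  have h2 : ∀ᶠ x in 𝓝[>] (0 : ℝ), l (2 * x) / l x < 2 :=
    (hslow.2 2 two_pos).eventually (gt_mem_nhds one_lt_two)
  obtain ⟨x1, hx1, hx⟩ := mem_nhdsGT_iff_exists_Ioo_subset.1 h2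
  rw [Set.mem_Ioi] at hx1
  obtain ⟨x0, hx0, hx01, hx01'⟩ : ∃ x0, 0 < x0 ∧ x0 ≤ x1 ∧ x0 ≤ 1 :=
    ⟨min x1 1, lt_min hx1 one_pos, min_le_left _ _, min_le_right _ _⟩
  have hl := hslow.1 (x0 / 2) (by linarith)
  refine ⟨l (x0 / 2), hl, ?_⟩
  -- Induction on the number of doublings that carry `x` past `x0 / 2`: below that point `l x > l
  -- (2x) / 2`, so a linear lower bound at `2x` passes to `x`.
  have key : ∀ n : ℕ, ∀ x, 0 < x → x0 / 2 ≤ 2 ^ n * x → x ≤ 1 → l (x0 / 2) * x ≤ l x := by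
    have big : ∀ x, x0 / 2 ≤ x → x ≤ 1 → l (x0 / 2) * x ≤ l x := fun x hxx hx1 =>
      (mul_le_of_le_one_right hl.le hx1).trans
        (hmono (Set.mem_Ioi.2 (by linarith)) (Set.mem_Ioi.2 (by linarith)) hxx)
    intro n
    induction n with
    | zero => intro x _ h hx1; exact big x (by simpa using h) hx1
    | succ n ih =>
      intro x hx0' h hx1
      rcases le_or_gt (x0 / 2) x with hc | hc
      · exact big x hc hx1
      · have := ih (2 * x) (by linarith) (by rw [pow_succ] at h; linarith) (by linarith)
        have h3 : l (2 * x) / l x < 2 := hx ⟨hx0', by linarith⟩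
        rw [div_lt_iff₀ (hslow.1 x hx0')] at h3
        linarith
  intro x hx0' hx1
  obtain ⟨n, hn⟩ := pow_unbounded_of_one_lt (x0 / 2 / x) (one_lt_two)
  exact key n x hx0' ((div_le_iff₀ hx0').1 hn.le) hx1

/-- Near `0` slow variation gives the factor `1/2`; away from `0`, `l (B w) ≤ 1` and `l w ≥ l x0`
suffice. This makes the comparison uniform in `w`, so that the final constant depends on `l` alone.
-/
theorem SlowlyVaryingAtZero.exists_mul_comp_le {l : ℝ → ℝ}
    (hrange : ∀ u, 0 < u → l u ∈ Set.Icc (0 : ℝ) 1) (hmono : MonotoneOn l (Set.Ioi 0))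
    (hslow : SlowlyVaryingAtZero l) {B : ℝ} (hB : 0 < B) :
    ∃ c, 0 < c ∧ c ≤ 1 ∧ ∀ w, 0 < w → c * l (B * w) ≤ l w := by
  have h2 : ∀ᶠ x in 𝓝[>] (0 : ℝ), l (B * x) / l x < 2 :=
    (hslow.2 B hB).eventually (gt_mem_nhds one_lt_two)
  obtain ⟨x0, hx0, hx⟩ := mem_nhdsGT_iff_exists_Ioo_subset.1 h2
  rw [Set.mem_Ioi] at hx0
  refine ⟨min (1 / 2) (l x0), lt_min (by norm_num) (hslow.1 _ hx0),
    (min_le_left _ _).trans (by norm_num), fun w hw => ?_⟩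
  have hBw := hrange (B * w) (by positivity)
  rcases lt_or_ge w x0 with h | h
  · have h3 : l (B * w) / l w < 2 := hx ⟨hw, h⟩
    rw [div_lt_iff₀ (hslow.1 w hw)] at h3
    have := mul_le_mul_of_nonneg_right (min_le_left (1 / 2) (l x0)) hBw.1
    linarith
  · have h4 := hmono (Set.mem_Ioi.2 hx0) (Set.mem_Ioi.2 hw) h
    have h5 := mul_le_mul_of_nonneg_right (min_le_right (1 / 2) (l x0)) hBw.1
    have h6 := mul_le_of_le_one_right (hslow.1 _ hx0).le hBw.2
    linarith

/-! ### One-step drifts and the two potential functions. -/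

section Drift

theorem apply_le_one {A : Type*} [Fintype A] {q : A → ℝ} (hpos : ∀ a, 0 < q a) (hq : ∑ a, q a = 1) (a : A) :
    q a ≤ 1 :=
  hq ▸ Finset.single_le_sum (fun b _ => (hpos b).le) (Finset.mem_univ a)

variable {A : Type*} [Fintype A] [DecidableEq A]

/-- The new state when arm `b` is played and rewarded. -/
noncomputable def rewardUpdate (α : ℝ → ℝ) (q : A → ℝ) (lead b : A) : A → ℝ :=
  sambaUpdate α q lead (Pi.single b 1)

/-- The expected increment of `f` in one SAMBA step from `q`, given the leading arm. -/
noncomputable def sambaDrift (r : A → ℝ) (α : ℝ → ℝ) (q : A → ℝ) (lead : A)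
    (f : (A → ℝ) → ℝ) : ℝ :=
  ∑ b, q b * r b * (f (rewardUpdate α q lead b) - f q)

theorem sambaUpdate_sum (α : ℝ → ℝ) (q : A → ℝ) (lead : A) (y : A → ℝ) :
    ∑ a, sambaUpdate α q lead y a = 1 := by
  rw [← Finset.add_sum_erase _ _ (Finset.mem_univ lead)]
  unfold sambaUpdate
  simp only [if_true]
  rw [sub_add_eq_add_sub, sub_eq_iff_eq_add]
  congr 1
  exact Finset.sum_congr rfl fun b hb => by rw [if_neg (Finset.ne_of_mem_erase hb)]

/-- An unrewarded play does not move the state, which is why the drift only involves rewarded plays,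
of probability `q b * r b`. -/
theorem sambaUpdate_zero {α : ℝ → ℝ} {q : A → ℝ} (hq : ∑ a, q a = 1) (lead : A) :
    sambaUpdate α q lead 0 = q := by
  funext a
  unfold sambaUpdate
  simp only [Pi.zero_apply, zero_div, sub_zero, mul_zero, add_zero]
  split_ifs with h
  · subst h
    rw [← hq, ← Finset.add_sum_erase _ _ (Finset.mem_univ a)]; ring
  · rfl

theorem rewardUpdate_lead_of_ne (α : ℝ → ℝ) (q : A → ℝ)
    {lead a : A} (h : a ≠ lead) :
    rewardUpdate α q lead lead a = q a - α (q a) * q a ^ 2 / q lead := by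
  unfold rewardUpdate sambaUpdate
  simp only [if_neg h, Pi.single_eq_same, Pi.single_eq_of_ne h]
  ring

theorem rewardUpdate_same_of_ne {α : ℝ → ℝ} {q : A → ℝ} (hpos : ∀ a, 0 < q a)
    {lead a : A} (h : a ≠ lead) :
    rewardUpdate α q lead a a = q a + α (q a) * q a := by
  unfold rewardUpdate sambaUpdate
  simp only [if_neg h, Pi.single_eq_same, Pi.single_eq_of_ne (Ne.symm h)]
  have := (hpos a).ne'
  field_simp
  ring

theorem rewardUpdate_of_ne {α : ℝ → ℝ} {q : A → ℝ} {lead a b : A} (h : a ≠ lead)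
    (hb : b ≠ lead) (hab : a ≠ b) : rewardUpdate α q lead b a = q a := by
  unfold rewardUpdate sambaUpdate
  simp [if_neg h, Pi.single_eq_of_ne hab, Pi.single_eq_of_ne (Ne.symm hb)]

theorem rewardUpdate_apply_lead (α : ℝ → ℝ) (q : A → ℝ) (lead b : A) :
    rewardUpdate α q lead b lead
      = 1 - ∑ a ∈ Finset.univ.erase lead, rewardUpdate α q lead b a := by
  have := sambaUpdate_sum α q lead (Pi.single b 1)
  rw [← Finset.add_sum_erase _ _ (Finset.mem_univ lead)] at this
  exact eq_sub_of_add_eq this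

theorem rewardUpdate_lead_lead {α : ℝ → ℝ} {q : A → ℝ}
    (hq : ∑ a, q a = 1) (lead : A) :
    rewardUpdate α q lead lead lead
      = q lead + (∑ a ∈ Finset.univ.erase lead, α (q a) * q a ^ 2) / q lead := by
  rw [rewardUpdate_apply_lead, Finset.sum_congr rfl fun a ha =>
    rewardUpdate_lead_of_ne α q (Finset.ne_of_mem_erase ha), Finset.sum_sub_distrib,
    ← Finset.sum_div, ← hq, ← Finset.add_sum_erase _ _ (Finset.mem_univ lead)]
  ring

theorem rewardUpdate_ne_lead {α : ℝ → ℝ} {q : A → ℝ} (hpos : ∀ a, 0 < q a)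
    (hq : ∑ a, q a = 1) {lead b : A} (h : b ≠ lead) :
    rewardUpdate α q lead b lead = q lead - α (q b) * q b := by
  have hb : b ∈ Finset.univ.erase lead := by simp [h]
  rw [rewardUpdate_apply_lead, ← Finset.add_sum_erase _ _ hb, rewardUpdate_same_of_ne hpos h,
    Finset.sum_congr rfl fun a ha => rewardUpdate_of_ne (α := α) (q := q)
      (Finset.ne_of_mem_erase (Finset.mem_of_mem_erase ha)) h (Finset.ne_of_mem_erase ha),
    ← hq, ← Finset.add_sum_erase _ _ (Finset.mem_univ lead), ← Finset.add_sum_erase _ _ hb]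
  ring

/-- One SAMBA step at most halves each probability. -/
theorem half_le_rewardUpdate {α : ℝ → ℝ} (hα : ∀ x, 0 < x → x ≤ 1 → α x ∈ Set.Ioc 0 (1 / 2))
    {q : A → ℝ} (hpos : ∀ a, 0 < q a) (hq : ∑ a, q a = 1) {lead : A}
    (hlead : ∀ b, q b ≤ q lead) (b a : A) : q a / 2 ≤ rewardUpdate α q lead b a := by
  have hα' : ∀ c, 0 < α (q c) ∧ α (q c) ≤ 1 / 2 := fun c =>
    hα _ (hpos c) (apply_le_one hpos hq c)
  by_cases ha : a = lead
  · subst ha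
    by_cases hb : b = a
    · subst hb
      rw [rewardUpdate_lead_lead hq]
      have : 0 ≤ (∑ c ∈ Finset.univ.erase b, α (q c) * q c ^ 2) / q b :=
        div_nonneg (Finset.sum_nonneg fun c _ => mul_nonneg (hα' c).1.le (sq_nonneg _))
          (hpos b).le
      linarith [hpos b]
    · rw [rewardUpdate_ne_lead hpos hq hb]
      nlinarith [hα' b, hpos b, hlead b]
  · by_cases hb : b = lead
    · subst hb
      rw [rewardUpdate_lead_of_ne α q ha]
      have : α (q a) * q a ^ 2 / q b ≤ q a / 2 := by
        rw [div_le_iff₀ (hpos b)]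
        have h1 : α (q a) * q a ^ 2 ≤ 1 / 2 * q a ^ 2 :=
          mul_le_mul_of_nonneg_right (hα' a).2 (sq_nonneg _)
        nlinarith [hlead a, hpos a]
      linarith
    · by_cases hab : a = b
      · subst hab
        rw [rewardUpdate_same_of_ne hpos ha]
        nlinarith [hα' a, hpos a]
      · rw [rewardUpdate_of_ne ha hb hab]
        linarith [hpos a]

theorem sambaDrift_lead {r : A → ℝ} {α : ℝ → ℝ} {q : A → ℝ} (hpos : ∀ a, 0 < q a)
    (hq : ∑ a, q a = 1) (s : A) (φ : ℝ → ℝ) :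
    sambaDrift r α q s (fun q => φ (q s))
      = q s * r s * (φ (q s + (∑ a ∈ Finset.univ.erase s, α (q a) * q a ^ 2) / q s) - φ (q s))
        + ∑ b ∈ Finset.univ.erase s, q b * r b * (φ (q s - α (q b) * q b) - φ (q s)) := by
  unfold sambaDrift
  rw [← Finset.add_sum_erase _ _ (Finset.mem_univ s)]
  beta_reduce
  rw [rewardUpdate_lead_lead hq]
  congr 1
  exact Finset.sum_congr rfl fun b hb => by
    rw [rewardUpdate_ne_lead hpos hq (Finset.ne_of_mem_erase hb)]

theorem sambaDrift_of_ne {r : A → ℝ} {α : ℝ → ℝ} {q : A → ℝ} (hpos : ∀ a, 0 < q a)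
    {s lead : A} (h : s ≠ lead) (φ : ℝ → ℝ) :
    sambaDrift r α q lead (fun q => φ (q s))
      = q s * r s * (φ (q s + α (q s) * q s) - φ (q s))
        + q lead * r lead * (φ (q s - α (q s) * q s ^ 2 / q lead) - φ (q s)) := by
  unfold sambaDrift
  have hl : lead ∈ Finset.univ.erase s := by simp [Ne.symm h]
  rw [← Finset.add_sum_erase _ _ (Finset.mem_univ s), ← Finset.add_sum_erase _ _ hl,
    Finset.sum_eq_zero fun b hb => ?_, add_zero]
  · beta_reduce
    rw [rewardUpdate_same_of_ne hpos h, rewardUpdate_lead_of_ne α q h]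
  beta_reduce
  rw [rewardUpdate_of_ne h (Finset.ne_of_mem_erase hb)
    (Finset.ne_of_mem_erase (Finset.mem_of_mem_erase hb)).symm]
  ring

theorem sambaDrift_coord_lead {r : A → ℝ} {α : ℝ → ℝ} {q : A → ℝ} (hpos : ∀ a, 0 < q a)
    (hq : ∑ a, q a = 1) (s : A) :
    sambaDrift r α q s (fun q => q s)
      = ∑ a ∈ Finset.univ.erase s, α (q a) * q a ^ 2 * (r s - r a) := by
  refine (sambaDrift_lead hpos hq s fun x => x).trans ?_
  have : q s ≠ 0 := (hpos s).ne'
  have e : q s * r s * (q s + (∑ a ∈ Finset.univ.erase s, α (q a) * q a ^ 2) / q s - q s)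
      = ∑ a ∈ Finset.univ.erase s, α (q a) * q a ^ 2 * r s := by
    rw [← Finset.sum_mul]; field_simp; ring
  rw [e, ← Finset.sum_add_distrib]
  exact Finset.sum_congr rfl fun a _ => by ring

theorem sambaDrift_coord_of_ne {r : A → ℝ} {α : ℝ → ℝ} {q : A → ℝ} (hpos : ∀ a, 0 < q a)
    {s lead : A} (h : s ≠ lead) :
    sambaDrift r α q lead (fun q => q s) = α (q s) * q s ^ 2 * (r s - r lead) := by
  refine (sambaDrift_of_ne hpos h fun x => x).trans ?_
  have : q lead ≠ 0 := (hpos lead).ne'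
  field_simp
  ring

/-- Second-order Taylor bound. With `y = x + d`, the numerator factor in the remainder is `8y² - 2xy
- x² = (4y + x)(2y - x)`, nonnegative exactly because a step at most halves `x`. -/
theorem inv_sq_add_sub_le {x d : ℝ} (hx : 0 < x) (hd : x / 2 ≤ x + d) :
    ((x + d) ^ 2)⁻¹ - (x ^ 2)⁻¹ ≤ -2 * d / x ^ 3 + 8 * d ^ 2 / x ^ 4 := by
  have hy : 0 < x + d := by linarith
  have key : -2 * d / x ^ 3 + 8 * d ^ 2 / x ^ 4 - (((x + d) ^ 2)⁻¹ - (x ^ 2)⁻¹)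
      = d ^ 2 * (8 * (x + d) ^ 2 - 3 * x ^ 2 - 2 * x * d) / (x ^ 4 * (x + d) ^ 2) := by
    field_simp
    ring
  have h1 : 0 ≤ 8 * (x + d) ^ 2 - 3 * x ^ 2 - 2 * x * d := by nlinarith
  have : 0 ≤ d ^ 2 * (8 * (x + d) ^ 2 - 3 * x ^ 2 - 2 * x * d) / (x ^ 4 * (x + d) ^ 2) := by
    positivity
  linarith

theorem sambaDrift_inv_sq_le {r : A → ℝ} (hr : ∀ a, r a ∈ Set.Icc (0 : ℝ) 1) {α : ℝ → ℝ}
    (hα : ∀ x, 0 < x → x ≤ 1 → α x ∈ Set.Ioc 0 (1 / 2))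
    {q : A → ℝ} (hpos : ∀ a, 0 < q a) (hq : ∑ a, q a = 1) {lead : A}
    (hlead : ∀ b, q b ≤ q lead) (s : A) :
    sambaDrift r α q lead (fun q => (q s ^ 2)⁻¹)
      ≤ -2 * sambaDrift r α q lead (fun q => q s) / q s ^ 3
        + 8 * (∑ b, q b * r b * (rewardUpdate α q lead b s - q s) ^ 2) / q s ^ 4 := by
  unfold sambaDrift
  simp only [Finset.mul_sum, Finset.sum_div, ← Finset.sum_add_distrib]
  refine Finset.sum_le_sum fun b _ => ?_
  have h := inv_sq_add_sub_le (x := q s) (d := rewardUpdate α q lead b s - q s) (hpos s)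
    (by simpa using half_le_rewardUpdate hα hpos hq hlead b s)
  rw [add_sub_cancel] at h
  refine (mul_le_mul_of_nonneg_left h (mul_nonneg (hpos b).le (hr b).1)).trans_eq ?_
  ring

/-- With `G` the sum on the right, the leader's upward jump is `G / q s` with `G ≤ 1`, contributing
at most `G / q s`; the downward jumps contribute at most `G ≤ G / q s`. -/
theorem sum_sq_increment_lead_le {r : A → ℝ} (hr : ∀ a, r a ∈ Set.Icc (0 : ℝ) 1) {α : ℝ → ℝ}
    (hα : ∀ x, 0 < x → x ≤ 1 → α x ∈ Set.Ioc 0 (1 / 2))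
    {q : A → ℝ} (hpos : ∀ a, 0 < q a) (hq : ∑ a, q a = 1) (s : A) :
    ∑ b, q b * r b * (rewardUpdate α q s b s - q s) ^ 2
      ≤ (∑ a ∈ Finset.univ.erase s, α (q a) * q a ^ 2) * (2 / q s) := by
  set G := ∑ a ∈ Finset.univ.erase s, α (q a) * q a ^ 2 with hG
  have hs := hpos s
  have hs1 := apply_le_one hpos hq s
  have hα' : ∀ c, 0 < α (q c) ∧ α (q c) ≤ 1 / 2 := fun c =>
    hα _ (hpos c) (apply_le_one hpos hq c)
  have hG0 : 0 ≤ G := Finset.sum_nonneg fun c _ => mul_nonneg (hα' c).1.le (sq_nonneg _)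
  have hG1 : G ≤ 1 := by
    calc G ≤ ∑ a ∈ Finset.univ.erase s, q a := Finset.sum_le_sum fun a _ => by
          have h1 := apply_le_one hpos hq a
          have := hα' a
          have := hpos a
          have : q a ^ 2 ≤ q a := by nlinarith
          nlinarith
      _ ≤ 1 := hq ▸ Finset.sum_le_sum_of_subset_of_nonneg (Finset.subset_univ _)
          fun a _ _ => (hpos a).le
  rw [← Finset.add_sum_erase _ _ (Finset.mem_univ s), rewardUpdate_lead_lead hq]
  have h1 : q s * r s * (q s + G / q s - q s) ^ 2 ≤ G / q s := by
    have e : q s * r s * (q s + G / q s - q s) ^ 2 = G / q s * (r s * G) := by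
      field_simp; ring
    rw [e]
    exact mul_le_of_le_one_right (by positivity) (mul_le_one₀ (hr s).2 hG0 hG1)
  have h2 : ∑ b ∈ Finset.univ.erase s, q b * r b * (rewardUpdate α q s b s - q s) ^ 2 ≤ G := by
    refine Finset.sum_le_sum fun b hb => ?_
    rw [rewardUpdate_ne_lead hpos hq (Finset.ne_of_mem_erase hb)]
    have e : q b * r b * (q s - α (q b) * q b - q s) ^ 2
        = α (q b) * q b ^ 2 * (r b * (α (q b) * q b)) := by ring
    rw [e]
    have hb0 := hα' b
    have hb1 := hpos b
    refine mul_le_of_le_one_right (by have := hb0.1; positivity) (mul_le_one₀ (hr b).2 ?_ ?_)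
    · have := hb0.1; positivity
    · nlinarith [apply_le_one hpos hq b]
  have h3 : G ≤ G / q s := by
    rw [le_div_iff₀ hs]; exact mul_le_of_le_one_right hG0 hs1
  have e : G * (2 / q s) = G / q s + G / q s := by ring
  rw [e]
  linarith

/-- Only rewards of `s` and of the leader move a trailing coordinate `s`. The leader's `1 / q lead`
weight is harmless because `q s ≤ q lead`. -/
theorem sum_sq_increment_of_ne_le {r : A → ℝ} (hr : ∀ a, r a ∈ Set.Icc (0 : ℝ) 1) {α : ℝ → ℝ}
    {q : A → ℝ} (hpos : ∀ a, 0 < q a)  {s lead : A} (h : s ≠ lead) (hlead : ∀ b, q b ≤ q lead) :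
    ∑ b, q b * r b * (rewardUpdate α q lead b s - q s) ^ 2 ≤ 2 * α (q s) ^ 2 * q s ^ 3 := by
  have hl : lead ∈ Finset.univ.erase s := by simp [Ne.symm h]
  have hl0 := hpos lead
  have hs0 := hpos s
  rw [← Finset.add_sum_erase _ _ (Finset.mem_univ s), ← Finset.add_sum_erase _ _ hl,
    rewardUpdate_same_of_ne hpos h, rewardUpdate_lead_of_ne α q h,
    Finset.sum_eq_zero fun b hb => ?_, add_zero]
  · have h1 : q s * r s * (q s + α (q s) * q s - q s) ^ 2 = α (q s) ^ 2 * q s ^ 3 * r s := by ring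
    have h2 : q lead * r lead * (q s - α (q s) * q s ^ 2 / q lead - q s) ^ 2
        = α (q s) ^ 2 * q s ^ 3 * (q s / q lead * r lead) := by
      field_simp; ring
    rw [h1, h2]
    have h3 : q s / q lead * r lead ≤ 1 :=
      mul_le_one₀ ((div_le_one₀ hl0).2 (hlead s)) (hr lead).1 (hr lead).2
    have h4 : 0 ≤ α (q s) ^ 2 * q s ^ 3 := by positivity
    linarith [mul_le_of_le_one_right h4 h3, mul_le_of_le_one_right h4 (hr s).2]
  · rw [rewardUpdate_of_ne h (Finset.ne_of_mem_erase hb)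
      (Finset.ne_of_mem_erase (Finset.mem_of_mem_erase hb)).symm]
    ring

theorem mul_le_sambaDrift_lead {r : A → ℝ} {Δ : ℝ} {s : A} (hgap : ∀ a, a ≠ s → r a ≤ r s - Δ)
    {α : ℝ → ℝ} (hα : ∀ x, 0 < x → x ≤ 1 → α x ∈ Set.Ioc 0 (1 / 2))
    {q : A → ℝ} (hpos : ∀ a, 0 < q a) (hq : ∑ a, q a = 1) :
    Δ * ∑ a ∈ Finset.univ.erase s, α (q a) * q a ^ 2
      ≤ sambaDrift r α q s (fun q => q s) := by
  rw [sambaDrift_coord_lead hpos hq, Finset.mul_sum]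
  refine Finset.sum_le_sum fun a ha => ?_
  rw [mul_comm]
  exact mul_le_mul_of_nonneg_left (by linarith [hgap a (Finset.ne_of_mem_erase ha)])
    (mul_nonneg (hα _ (hpos a) (apply_le_one hpos hq a)).1.le (sq_nonneg _))

theorem mul_le_sambaDrift_of_ne {r : A → ℝ} {Δ : ℝ} {s : A} (hgap : ∀ a, a ≠ s → r a ≤ r s - Δ)
    {α : ℝ → ℝ} (hα : ∀ x, 0 < x → x ≤ 1 → α x ∈ Set.Ioc 0 (1 / 2))
    {q : A → ℝ} (hpos : ∀ a, 0 < q a) (hq : ∑ a, q a = 1) {lead : A} (h : s ≠ lead) :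
    Δ * (α (q s) * q s ^ 2) ≤ sambaDrift r α q lead (fun q => q s) := by
  rw [sambaDrift_coord_of_ne hpos h, mul_comm]
  exact mul_le_mul_of_nonneg_left (by linarith [hgap lead h.symm])
    (mul_nonneg (hα _ (hpos s) (apply_le_one hpos hq s)).1.le (sq_nonneg _))

theorem sambaDrift_coord_nonneg {r : A → ℝ} {Δ : ℝ} (hΔ : 0 < Δ) {s : A}
    (hgap : ∀ a, a ≠ s → r a ≤ r s - Δ)
    {α : ℝ → ℝ} (hα : ∀ x, 0 < x → x ≤ 1 → α x ∈ Set.Ioc 0 (1 / 2))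
    {q : A → ℝ} (hpos : ∀ a, 0 < q a) (hq : ∑ a, q a = 1) (lead : A) :
    0 ≤ sambaDrift r α q lead (fun q => q s) := by
  have hα' : ∀ c, 0 ≤ α (q c) * q c ^ 2 := fun c =>
    mul_nonneg (hα _ (hpos c) (apply_le_one hpos hq c)).1.le (sq_nonneg _)
  by_cases h : s = lead
  · subst h
    exact (mul_nonneg hΔ.le (Finset.sum_nonneg fun c _ => hα' c)).trans
      (mul_le_sambaDrift_lead hgap hα hpos hq)
  · exact (mul_nonneg hΔ.le (hα' s)).trans (mul_le_sambaDrift_of_ne hgap hα hpos hq h)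

theorem sambaDrift_linear (r : A → ℝ) (α : ℝ → ℝ) (q : A → ℝ) (lead : A) (f g : (A → ℝ) → ℝ)
    (K : ℝ) : sambaDrift r α q lead (fun q => f q + K * (1 - g q))
      = sambaDrift r α q lead f - K * sambaDrift r α q lead g := by
  unfold sambaDrift
  rw [Finset.mul_sum, ← Finset.sum_sub_distrib]
  exact Finset.sum_congr rfl fun b _ => by ring

/-- A Lyapunov function: its drift is uniformly negative away from the vertex of the best arm. -/
theorem exists_lyapunov [Nonempty A] {r : A → ℝ} (hr : ∀ a, r a ∈ Set.Icc (0 : ℝ) 1)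
    {Δ : ℝ} (hΔ : 0 < Δ) {s : A} (hgap : ∀ a, a ≠ s → r a ≤ r s - Δ)
    {α : ℝ → ℝ} (hα : ∀ x, 0 < x → x ≤ 1 → α x ∈ Set.Ioc 0 (1 / 2))
    {k : ℝ} (hk : 0 < k) (hαk : ∀ x, 0 < x → x ≤ 1 → k * x ≤ α x)
    {x0 : ℝ} (hx0 : 0 < x0) (hαx0 : ∀ x, 0 < x → x < x0 → α x ≤ Δ / 16) :
    ∃ K, 0 ≤ K ∧ ∀ ε, 0 < ε → ε ≤ 1 / 2 → ∃ c, 0 < c ∧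
      ∀ (q : A → ℝ) (lead : A), (∀ a, 0 < q a) → ∑ a, q a = 1 → (∀ b, q b ≤ q lead) →
        sambaDrift r α q lead (fun q => (q s ^ 2)⁻¹ + K * (1 - q s))
          ≤ -c * (if q s ≤ 1 - ε then 1 else 0) := by
  set N : ℝ := (Fintype.card A : ℝ) with hN
  have hN0 : 0 < N := by rw [hN]; exact_mod_cast Fintype.card_pos
  -- In `K Δ`, the term `16 N⁵` absorbs the second-order term when `s` leads (then `q s ≥ 1/N`), `8
  -- / x0³` absorbs it when `s` trails with `q s ≥ x0`, and the `1` leaves a strictly negative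
  -- remainder.
  set K := (16 * N ^ 5 + 8 / x0 ^ 3 + 1) / Δ with hK
  have hKΔ : K * Δ = 16 * N ^ 5 + 8 / x0 ^ 3 + 1 := by rw [hK]; field_simp
  have hK0 : 0 ≤ K := by rw [hK]; positivity
  have hx3 : 0 < 8 / x0 ^ 3 := by positivity
  -- The three minimands serve three cases: `s` leads with `q s ≤ 1 - ε`; `s` trails with `q s <
  -- x0`; `s` trails with `q s ≥ x0`.
  refine ⟨K, hK0, fun ε hε hε2 => ⟨min (k * (ε / N) ^ 3) (min (Δ * k) (k * x0 ^ 3)),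
    by positivity, fun q lead hpos hq hlead => ?_⟩⟩
  set c := min (k * (ε / N) ^ 3) (min (Δ * k) (k * x0 ^ 3)) with hc
  have hc1 : c ≤ k * (ε / N) ^ 3 := min_le_left _ _
  have hc2 : c ≤ Δ * k := (min_le_right _ _).trans (min_le_left _ _)
  have hc3 : c ≤ k * x0 ^ 3 := (min_le_right _ _).trans (min_le_right _ _)
  have hc0 : 0 < c := by positivity
  have hα' : ∀ c, 0 < α (q c) ∧ α (q c) ≤ 1 / 2 := fun c =>
    hα _ (hpos c) (apply_le_one hpos hq c)
  have hs := hpos s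
  have hcube : ∀ a y, 0 ≤ y → y ≤ q a → k * y ^ 3 ≤ α (q a) * q a ^ 2 := fun a y hy hya => by
    calc k * y ^ 3 ≤ k * q a ^ 3 := by gcongr
      _ = k * q a * q a ^ 2 := by ring
      _ ≤ _ := mul_le_mul_of_nonneg_right (hαk _ (hpos a) (apply_le_one hpos hq a)) (sq_nonneg _)
  rw [sambaDrift_linear]
  have hinv := sambaDrift_inv_sq_le hr hα hpos hq hlead s
  set D := sambaDrift r α q lead (fun q => q s)
  have hD0 : 0 ≤ D := sambaDrift_coord_nonneg hΔ hgap hα hpos hq lead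
  by_cases h : s = lead
  · subst h
    set G := ∑ a ∈ Finset.univ.erase s, α (q a) * q a ^ 2 with hG
    have hG0 : 0 ≤ G := Finset.sum_nonneg fun c _ => mul_nonneg (hα' c).1.le (sq_nonneg _)
    have hD : Δ * G ≤ D := mul_le_sambaDrift_lead hgap hα hpos hq
    have hS := sum_sq_increment_lead_le hr hα hpos hq s
    have hqN : 1 ≤ N * q s := by
      rw [← hq]
      have := Finset.sum_le_card_nsmul Finset.univ q (q s) fun b _ => hlead b
      simpa [hN] using this
    have h1 : 8 * (∑ b, q b * r b * (rewardUpdate α q s b s - q s) ^ 2) / q s ^ 4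
        ≤ 16 * N ^ 5 * G := by
      rw [div_le_iff₀ (by positivity)]
      have h5 : 1 ≤ (N * q s) ^ 5 := one_le_pow₀ hqN
      calc _ ≤ 8 * (G * (2 / q s)) := by gcongr
        _ = 16 * G / q s * 1 := by ring
        _ ≤ 16 * G / q s * (N * q s) ^ 5 := by gcongr
        _ = _ := by field_simp
    have h2 : -2 * D / q s ^ 3 ≤ 0 :=
      div_nonpos_of_nonpos_of_nonneg (by linarith) (by positivity)
    have h3 : K * (Δ * G) ≤ K * D := mul_le_mul_of_nonneg_left hD hK0
    rw [← mul_assoc, hKΔ] at h3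
    have h4 : 0 ≤ 8 / x0 ^ 3 * G := by positivity
    have h5 : c * (if q s ≤ 1 - ε then 1 else 0) ≤ G := by
      split_ifs with hsε
      -- Pigeonhole: the fewer than `N` other arms share mass at least `ε`.
      · have hex : ∃ a ∈ Finset.univ.erase s, ε / N ≤ q a := by
          by_contra! hcon
          have hle : ∑ a ∈ Finset.univ.erase s, q a ≤ (Finset.univ.erase s).card • (ε / N) :=
            Finset.sum_le_card_nsmul _ _ _ fun a ha => (hcon a ha).le
          have hcard : ((Finset.univ.erase s).card : ℝ) = N - 1 := by
            rw [Finset.card_erase_of_mem (Finset.mem_univ s), Finset.card_univ,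
              Nat.cast_sub Fintype.card_pos, Nat.cast_one]
          rw [nsmul_eq_mul, hcard] at hle
          rw [← Finset.add_sum_erase _ _ (Finset.mem_univ s)] at hq
          have e1 : (N - 1) * (ε / N) = ε - ε / N := by field_simp
          have e2 : 0 < ε / N := by positivity
          linarith
        obtain ⟨a, ha, hεa⟩ := hex
        have := hcube a (ε / N) (by positivity) hεa
        have h6 := Finset.single_le_sum (f := fun a => α (q a) * q a ^ 2)
          (fun c _ => mul_nonneg (hα' c).1.le (sq_nonneg _)) ha
        linarith
      · linarith
    linarith
  · have hD : Δ * (α (q s) * q s ^ 2) ≤ D := mul_le_sambaDrift_of_ne hgap hα hpos hq h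
    have hS := sum_sq_increment_of_ne_le (α := α) hr hpos h hlead
    have h1 : 8 * (∑ b, q b * r b * (rewardUpdate α q lead b s - q s) ^ 2) / q s ^ 4
        ≤ 16 * α (q s) ^ 2 / q s := by
      rw [div_le_div_iff₀ (by positivity) hs]
      calc _ ≤ 8 * (2 * α (q s) ^ 2 * q s ^ 3) * q s := by gcongr
        _ = _ := by ring
    have h5 : c * (if q s ≤ 1 - ε then 1 else 0) ≤ c := by
      split_ifs <;> linarith
    have h3 : K * (Δ * (α (q s) * q s ^ 2)) ≤ K * D := mul_le_mul_of_nonneg_left hD hK0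
    rw [← mul_assoc, hKΔ] at h3
    have hα0 := (hα' s).1
    rcases lt_or_ge (q s) x0 with hx | hx
    -- Here `α ≤ Δ/16`, so the second-order term costs at most half of the first-order gain `2Δ α /
    -- q s`; the remaining half is at least `Δ k`.
    · have h6 : -2 * D / q s ^ 3 ≤ -2 * (Δ * (α (q s) * q s ^ 2)) / q s ^ 3 := by
        gcongr ?_ / _
        linarith
      have e : -2 * (Δ * (α (q s) * q s ^ 2)) / q s ^ 3 = -2 * Δ * (α (q s) / q s) := by
        field_simp
      have h7 : 16 * α (q s) ^ 2 / q s ≤ Δ * (α (q s) / q s) := by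
        have : 16 * α (q s) ^ 2 / q s = (16 * α (q s)) * (α (q s) / q s) := by ring
        rw [this]
        have := hαx0 _ hs hx
        gcongr
        linarith
      have h8 : Δ * k ≤ Δ * (α (q s) / q s) := by
        gcongr
        rw [le_div_iff₀ hs]
        exact hαk _ hs (apply_le_one hpos hq s)
      have h9 : 0 ≤ K * D := mul_nonneg hK0 hD0
      linarith
    · have h2 : -2 * D / q s ^ 3 ≤ 0 :=
        div_nonpos_of_nonpos_of_nonneg (by linarith) (by positivity)
      have h6 : 16 * α (q s) ^ 2 / q s ≤ 8 / x0 ^ 3 * (α (q s) * q s ^ 2) := by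
        calc 16 * α (q s) ^ 2 / q s = (16 * α (q s)) * α (q s) / q s := by ring
          _ ≤ 8 * α (q s) / q s := by gcongr; linarith [(hα' s).2]
          _ = 8 / q s ^ 3 * (α (q s) * q s ^ 2) := by field_simp
          _ ≤ _ := by gcongr
      have h7 := hcube s x0 hx0.le hx
      have h8 : 0 ≤ 16 * N ^ 5 * (α (q s) * q s ^ 2) := by positivity
      linarith

/-- The logarithmic potential controls the distance to the vertex of the best arm. -/
theorem sub_le_neg_sambaDrift_log [Nontrivial A] {r : A → ℝ}
    (hr : ∀ a, r a ∈ Set.Icc (0 : ℝ) 1)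
    {Δ : ℝ} (hΔ : 0 < Δ) {s : A} (hgap : ∀ a, a ≠ s → r a ≤ r s - Δ)
    {α : ℝ → ℝ} (hα : ∀ x, 0 < x → x ≤ 1 → α x ∈ Set.Ioc 0 (1 / 2))
    {δ m : ℝ} (hδ : 0 < δ) (hm : 0 < m)
    (hαm : ∀ x, δ / (Fintype.card A - 1) ≤ x → x ≤ 1 → m ≤ α x)
    {q : A → ℝ} (hpos : ∀ a, 0 < q a) (hq : ∑ a, q a = 1) {lead : A}
    (hlead : ∀ b, q b ≤ q lead) :
    (if q s ≤ 1 / 2 then 0 else 1 - q s - 3 * δ)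
      ≤ -((Fintype.card A - 1) / (Δ * m)) *
        sambaDrift r α q lead (fun q => Real.log (1 - q s + δ)) := by
  set n : ℝ := (Fintype.card A : ℝ) - 1 with hn
  have hn0 : 0 < n := by
    have : (1 : ℝ) < Fintype.card A := by exact_mod_cast Fintype.one_lt_card
    linarith
  set z := 1 - q s with hz
  have hz0 : 0 ≤ z := by linarith [apply_le_one hpos hq s]
  have hsum : ∑ a ∈ Finset.univ.erase s, q a = z := by
    rw [hz, ← hq, ← Finset.add_sum_erase _ _ (Finset.mem_univ s)]; ring
  have hα' : ∀ c, 0 < α (q c) ∧ α (q c) ≤ 1 / 2 := fun c =>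
    hα _ (hpos c) (apply_le_one hpos hq c)
  set D := sambaDrift r α q lead (fun q => q s) with hDdef
  have hD0 : 0 ≤ D := sambaDrift_coord_nonneg hΔ hgap hα hpos hq lead
  have hlog : sambaDrift r α q lead (fun q => Real.log (1 - q s + δ)) ≤ -(D / (z + δ)) := by
    rw [hDdef]
    unfold sambaDrift
    rw [Finset.sum_div, ← Finset.sum_neg_distrib]
    refine Finset.sum_le_sum fun b _ => ?_
    have hup : rewardUpdate α q lead b s ≤ 1 :=
      apply_le_one (fun a => lt_of_lt_of_le (by linarith [hpos a])
        (half_le_rewardUpdate hα hpos hq hlead b a)) (sambaUpdate_sum _ _ _ _) s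
    have h1 : Real.log (1 - rewardUpdate α q lead b s + δ) - Real.log (z + δ)
        ≤ -((rewardUpdate α q lead b s - q s) / (z + δ)) := by
      -- `log x ≤ x - 1` at the ratio of the new to the old potential argument.
      rw [← Real.log_div (by linarith) (by linarith)]
      refine (Real.log_le_sub_one_of_pos (div_pos (by linarith) (by linarith))).trans_eq ?_
      have : z + δ ≠ 0 := by linarith
      rw [hz] at this ⊢
      field_simp
      ring
    refine (mul_le_mul_of_nonneg_left h1 (mul_nonneg (hpos b).le (hr b).1)).trans_eq ?_
    ring
  have hneg : 0 ≤ n / (Δ * m) * (D / (z + δ)) := by positivity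
  have hmain : n / (Δ * m) * (D / (z + δ)) ≤
      -(n / (Δ * m)) * sambaDrift r α q lead (fun q => Real.log (1 - q s + δ)) := by
    have := mul_le_mul_of_nonneg_left hlog (show 0 ≤ n / (Δ * m) by positivity)
    linarith
  refine le_trans ?_ hmain
  split_ifs with hs
  · exact hneg
  rcases le_or_gt z (3 * δ) with hzδ | hzδ
  · linarith
  -- An arm of probability above `1/2` is the leader.
  have hls : s = lead := by
    by_contra hne
    have hl : lead ∈ Finset.univ.erase s := by simp [Ne.symm hne]
    have := Finset.single_le_sum (f := q) (fun a _ => (hpos a).le) hl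
    rw [hsum] at this
    linarith [hlead s]
  subst hls
  have hD : Δ * ∑ a ∈ Finset.univ.erase s, α (q a) * q a ^ 2 ≤ D :=
    mul_le_sambaDrift_lead hgap hα hpos hq
  have hcard : ((Finset.univ.erase s).card : ℝ) = n := by
    rw [Finset.card_erase_of_mem (Finset.mem_univ s), Finset.card_univ,
      Nat.cast_sub Fintype.card_pos, Nat.cast_one]
  -- Subtracting `δ / n` from each trailing coordinate costs `δ` in total, and the positive parts
  -- live only where `α ≥ m`. Cauchy–Schwarz is applied to these positive parts.
  have hG : m * (z - δ) ^ 2 ≤ n * ∑ a ∈ Finset.univ.erase s, α (q a) * q a ^ 2 := by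
    have h1 : z - δ ≤ ∑ a ∈ Finset.univ.erase s, max (q a - δ / n) 0 := by
      calc z - δ = ∑ a ∈ Finset.univ.erase s, (q a - δ / n) := by
            rw [Finset.sum_sub_distrib, hsum, Finset.sum_const, nsmul_eq_mul, hcard]
            field_simp
        _ ≤ _ := Finset.sum_le_sum fun a _ => le_max_left _ _
    have h2 := sq_sum_le_card_mul_sum_sq (s := Finset.univ.erase s)
      (f := fun a => max (q a - δ / n) 0)
    rw [hcard] at h2
    have h3 : (z - δ) ^ 2 ≤ (∑ a ∈ Finset.univ.erase s, max (q a - δ / n) 0) ^ 2 :=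
      pow_le_pow_left₀ (by linarith) h1 2
    have h4 : m * ∑ a ∈ Finset.univ.erase s, max (q a - δ / n) 0 ^ 2
        ≤ ∑ a ∈ Finset.univ.erase s, α (q a) * q a ^ 2 := by
      rw [Finset.mul_sum]
      refine Finset.sum_le_sum fun a _ => ?_
      rcases le_or_gt (δ / n) (q a) with h | h
      · rw [max_eq_left (by linarith)]
        have h5 := hαm (q a) h (apply_le_one hpos hq a)
        have h6 : 0 < δ / n := by positivity
        have h7 : (q a - δ / n) ^ 2 ≤ q a ^ 2 := pow_le_pow_left₀ (by linarith) (by linarith) 2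
        exact mul_le_mul h5 h7 (sq_nonneg _) (hα' a).1.le
      · rw [max_eq_right (by linarith)]
        have := (hα' a).1
        have : 0 ≤ α (q a) * q a ^ 2 := by positivity
        simpa using this
    calc m * (z - δ) ^ 2 ≤ m * (n * ∑ a ∈ Finset.univ.erase s, max (q a - δ / n) 0 ^ 2) := by
          gcongr; exact h3.trans h2
      _ = n * (m * ∑ a ∈ Finset.univ.erase s, max (q a - δ / n) 0 ^ 2) := by ring
      _ ≤ _ := by gcongr
  have hzp : 0 < z + δ := by linarith
  rw [div_mul_div_comm, le_div_iff₀ (by positivity)]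
  -- The left side is `(z - δ)² - 4δ²`; this is where the loss `3δ` comes from.
  have h8 : (z - 3 * δ) * (z + δ) ≤ (z - δ) ^ 2 := by nlinarith [sq_nonneg δ]
  calc (z - 3 * δ) * (Δ * m * (z + δ)) = Δ * (m * ((z - 3 * δ) * (z + δ))) := by ring
    _ ≤ Δ * (m * (z - δ) ^ 2) := by gcongr
    _ ≤ Δ * (n * ∑ a ∈ Finset.univ.erase s, α (q a) * q a ^ 2) := by gcongr
    _ = n * (Δ * ∑ a ∈ Finset.univ.erase s, α (q a) * q a ^ 2) := by ring
    _ ≤ n * D := by gcongr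

end Drift

/-! ### Finitely valued random variables. -/

section SimpleMeasurable

/-- `f` takes finitely many values, and each of its level sets is measurable for `m`. -/
def IsSimpleMeasurable {Ω β : Type*} (m : MeasurableSpace Ω) (f : Ω → β) : Prop :=
  (Set.range f).Finite ∧ ∀ S : Set β, MeasurableSet[m] (f ⁻¹' S)

namespace IsSimpleMeasurable

variable {Ω β γ : Type*} {m m' : MeasurableSpace Ω}

theorem of_singleton {f : Ω → β} (hf : (Set.range f).Finite)
    (h : ∀ x, MeasurableSet[m] (f ⁻¹' {x})) : IsSimpleMeasurable m f := by
  refine ⟨hf, fun S => ?_⟩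
  have e : f ⁻¹' S = ⋃ x ∈ Set.range f ∩ S, f ⁻¹' {x} := by
    ext ω; simp
  rw [e]
  exact MeasurableSet.biUnion (hf.subset Set.inter_subset_left).countable fun x _ => h x

theorem of_measurable [MeasurableSpace β] [MeasurableSingletonClass β] {f : Ω → β}
    (hf : (Set.range f).Finite) (h : Measurable[m] f) : IsSimpleMeasurable m f :=
  of_singleton hf fun x => h (measurableSet_singleton x)

theorem mono {f : Ω → β} (hf : IsSimpleMeasurable m f) (h : m ≤ m') : IsSimpleMeasurable m' f :=
  ⟨hf.1, fun S => h _ (hf.2 S)⟩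

/-- No measurability of `g` is needed. Since rewards and arms take finitely many values, so does
each `p t`, and every functional of the state is measurable and integrable. -/
theorem comp {f : Ω → β} (hf : IsSimpleMeasurable m f) (g : β → γ) :
    IsSimpleMeasurable m fun ω => g (f ω) :=
  ⟨by simpa [← Set.range_comp] using! hf.1.image g, fun S => hf.2 (g ⁻¹' S)⟩

theorem prodMk {f : Ω → β} {g : Ω → γ} (hf : IsSimpleMeasurable m f)
    (hg : IsSimpleMeasurable m g) : IsSimpleMeasurable m fun ω => (f ω, g ω) := by
  refine of_singleton ((hf.1.prod hg.1).subset ?_) fun x => ?_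
  · rintro _ ⟨ω, rfl⟩; exact ⟨⟨ω, rfl⟩, ⟨ω, rfl⟩⟩
  · have e : (fun ω => (f ω, g ω)) ⁻¹' {x} = f ⁻¹' {x.1} ∩ g ⁻¹' {x.2} := by
      ext ω; simp [Prod.ext_iff]
    rw [e]
    exact MeasurableSet.inter (hf.2 _) (hg.2 _)

theorem mul {f g : Ω → ℝ} (hf : IsSimpleMeasurable m f) (hg : IsSimpleMeasurable m g) :
    IsSimpleMeasurable m fun ω => f ω * g ω :=
  (hf.prodMk hg).comp fun x => x.1 * x.2

theorem indicator_one {H : Set Ω} (hH : MeasurableSet[m] H) :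
    IsSimpleMeasurable m (H.indicator fun _ => (1 : ℝ)) := by
  refine of_measurable ?_ (measurable_const.indicator hH)
  refine (Set.toFinite {(0 : ℝ), 1}).subset ?_
  rintro _ ⟨ω, rfl⟩
  by_cases h : ω ∈ H <;> simp [h]

theorem measurable [MeasurableSpace β] {f : Ω → β} (hf : IsSimpleMeasurable m f) :
    Measurable[m] f := fun S _ => hf.2 S

theorem exists_bound {f : Ω → ℝ} (hf : IsSimpleMeasurable m f) : ∃ c, ∀ ω, ‖f ω‖ ≤ c := by
  obtain ⟨c, hc⟩ := hf.1.isBounded.exists_norm_le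
  exact ⟨c, fun ω => hc _ ⟨ω, rfl⟩⟩

theorem integrable {m0 : MeasurableSpace Ω} {μ : Measure Ω} [IsFiniteMeasure μ] {f : Ω → ℝ}
    (hf : IsSimpleMeasurable m f) (hm : m ≤ m0) : Integrable f μ := by
  obtain ⟨c, hc⟩ := hf.exists_bound
  exact Integrable.of_bound (hf.mono hm).measurable.aestronglyMeasurable c
    (Eventually.of_forall hc)

theorem integral_mul_of_condExp {m0 : MeasurableSpace Ω} {μ : Measure Ω} [IsFiniteMeasure μ]
    (hm : m ≤ m0) {X Y Z : Ω → ℝ} (hX : IsSimpleMeasurable m X) (hY : Integrable Y μ)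
    (h : μ[Y | m] =ᵐ[μ] Z) : ∫ ω, X ω * Y ω ∂μ = ∫ ω, X ω * Z ω ∂μ := by
  obtain ⟨c, hc⟩ := hX.exists_bound
  have h1 := condExp_stronglyMeasurable_mul_of_bound hm (μ := μ)
    hX.measurable.stronglyMeasurable hY c (Eventually.of_forall hc)
  calc ∫ ω, X ω * Y ω ∂μ = ∫ ω, (μ[X * Y | m]) ω ∂μ := (integral_condExp hm).symm
    _ = ∫ ω, X ω * Z ω ∂μ := integral_congr_ae (by
        filter_upwards [h1, h] with ω h1 h
        rw [h1, Pi.mul_apply, h])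

end IsSimpleMeasurable

end SimpleMeasurable

theorem isSimpleMeasurable_of_finite {A Ω : Type*} [Finite A] [MeasurableSpace A]
    [MeasurableSingletonClass A] (X : Ω → A) :
    IsSimpleMeasurable (MeasurableSpace.comap X inferInstance) X :=
  .of_measurable (Set.toFinite _) (comap_measurable X)

/-! ### The process along its history: conditional expectations tested against past variables. -/

section History

variable {A Ω : Type*} [DecidableEq A] [MeasurableSpace A] {R : ℕ → A → Ω → ℝ}
  {arm lead : ℕ → Ω → A}

theorem history_mono : Monotone (history R arm lead) := fun _ _ h =>
  biSup_mono fun _ hi => lt_of_lt_of_le hi h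

theorem comap_le_history {s t : ℕ} (h : s < t) :
    MeasurableSpace.comap (lead s) inferInstance ⊔ MeasurableSpace.comap (arm s) inferInstance ⊔
      MeasurableSpace.comap (fun ω a => played arm a s ω * R s a ω) inferInstance
      ≤ history R arm lead t :=
  le_biSup (f := fun s => MeasurableSpace.comap (lead s) inferInstance ⊔
    MeasurableSpace.comap (arm s) inferInstance ⊔
      MeasurableSpace.comap (fun ω a => played arm a s ω * R s a ω) inferInstance) h

end History

section Bandit

variable {A Ω : Type*} [Fintype A] [DecidableEq A] [MeasurableSpace A]
  [mΩ : MeasurableSpace Ω] {μ : Measure Ω} {r : A → ℝ} {α : ℝ → ℝ} {p0 : A → ℝ}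
  {R : ℕ → A → Ω → ℝ} {arm lead : ℕ → Ω → A} {p : ℕ → Ω → A → ℝ}

namespace IsSamba

theorem played_mul_eq (h : IsSamba μ r α p0 R arm lead p) (t : ℕ) (ω : Ω) :
    (fun a => played arm a t ω * R t a ω)
      = if R t (arm t ω) ω = 1 then Pi.single (arm t ω) 1 else 0 := by
  funext a
  unfold played
  by_cases ha : arm t ω = a
  · subst ha
    rcases h.reward_values t (arm t ω) ω with h0 | h0 <;> simp [h0]
  · rw [if_neg ha]
    split_ifs <;> simp [Ne.symm ha]

theorem simplex (h : IsSamba μ r α p0 R arm lead p)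
    (hα : ∀ x, 0 < x → x ≤ 1 → α x ∈ Set.Ioc 0 (1 / 2))
    (hp0 : ∀ a, 0 < p0 a) (hp1 : ∑ a, p0 a = 1) (t : ℕ) (ω : Ω) :
    (∀ a, 0 < p t ω a) ∧ ∑ a, p t ω a = 1 := by
  induction t with
  | zero => rw [h.init]; exact ⟨hp0, hp1⟩
  | succ t ih =>
    rw [h.step, h.played_mul_eq]
    have hl : ∀ b, p t ω b ≤ p t ω (lead t ω) := by
      simpa [maximizers] using h.lead_mem t ω
    split_ifs with hR
    · refine ⟨fun a => ?_, sambaUpdate_sum _ _ _ _⟩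
      have := half_le_rewardUpdate hα ih.1 ih.2 hl (arm t ω) a
      exact lt_of_lt_of_le (by linarith [ih.1 a]) this
    · rw [sambaUpdate_zero ih.2]; exact ih

theorem apply_step (h : IsSamba μ r α p0 R arm lead p)
    {t : ℕ} {ω : Ω} (hq : ∑ a, p t ω a = 1) (f : (A → ℝ) → ℝ) :
    f (p (t + 1) ω) = f (p t ω) + ∑ b, (f (rewardUpdate α (p t ω) (lead t ω) b) - f (p t ω)) *
      played arm b t ω * R t b ω := by
  rw [Finset.sum_eq_single (arm t ω)]
  · rw [h.step, h.played_mul_eq]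
    unfold played rewardUpdate
    rcases h.reward_values t (arm t ω) ω with h0 | h0
    · simp [h0, sambaUpdate_zero hq]
    · simp [h0]
  · intro b _ hb
    simp [played, Ne.symm hb]
  · simp

theorem isSimpleMeasurable_played (h : IsSamba μ r α p0 R arm lead p) (t : ℕ) :
    IsSimpleMeasurable
      (MeasurableSpace.comap (fun ω a => played arm a t ω * R t a ω) inferInstance)
      (fun ω a => played arm a t ω * R t a ω) := by
  refine .of_measurable ?_ (comap_measurable _)
  refine (Set.Finite.pi' (t := fun _ : A => {(0 : ℝ), 1}) fun _ => Set.toFinite _).subset ?_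
  rintro _ ⟨ω, rfl⟩ a
  unfold played
  rcases h.reward_values t a ω with h0 | h0 <;> by_cases ha : arm t ω = a <;> simp [h0, ha]

theorem integral_reward (h : IsSamba μ r α p0 R arm lead p) (t : ℕ) (a : A) :
    ∫ ω, R t a ω ∂μ = r a := by
  have e : R t a = {ω | R t a ω = 1}.indicator fun _ => (1 : ℝ) := by
    funext ω
    rcases h.reward_values t a ω with h0 | h0 <;> simp [Set.indicator, h0]
  rw [← h.reward_law t a]
  have hm : MeasurableSet {ω | R t a ω = 1} := h.measurable_reward t a (measurableSet_singleton 1)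
  conv_lhs => rw [e]
  rw [integral_indicator_const _ hm]
  simp

variable [MeasurableSingletonClass A]

theorem history_le (h : IsSamba μ r α p0 R arm lead p) (t : ℕ) : history R arm lead t ≤ mΩ := by
  refine iSup₂_le fun s _ => sup_le (sup_le ?_ ?_) ?_
  · exact (h.measurable_lead s).comap_le
  · exact (h.measurable_arm s).comap_le
  · refine (measurable_pi_lambda _ fun a => Measurable.mul ?_ (h.measurable_reward s a)).comap_le
    exact Measurable.ite (h.measurable_arm s (measurableSet_singleton a)) measurable_const
      measurable_const

theorem history_lead_le (h : IsSamba μ r α p0 R arm lead p) (t : ℕ) :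
    history R arm lead t ⊔ MeasurableSpace.comap (lead t) inferInstance ≤ mΩ :=
  sup_le (h.history_le t) (h.measurable_lead t).comap_le

theorem isSimpleMeasurable (h : IsSamba μ r α p0 R arm lead p) (t : ℕ) :
    IsSimpleMeasurable (history R arm lead t) (p t) := by
  induction t with
  | zero =>
    have e : p 0 = fun _ => p0 := funext h.init
    rw [e]
    exact .of_measurable (Set.finite_range_const) measurable_const
  | succ t ih =>
    have hle := comap_le_history (R := R) (arm := arm) (lead := lead) (Nat.lt_succ_self t)
    have hs := (ih.mono (history_mono t.le_succ)).prodMk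
      (((isSimpleMeasurable_of_finite (lead t)).mono
        ((le_sup_left.trans le_sup_left).trans hle)).prodMk
        ((h.isSimpleMeasurable_played t).mono (le_sup_right.trans hle)))
    rw [funext (h.step t)]
    exact hs.comp fun x => sambaUpdate α x.1 x.2.1 x.2.2

theorem isSimpleMeasurable_lead (h : IsSamba μ r α p0 R arm lead p) (t : ℕ) :
    IsSimpleMeasurable (history R arm lead t ⊔ MeasurableSpace.comap (lead t) inferInstance)
      (fun ω => (p t ω, lead t ω)) :=
  ((h.isSimpleMeasurable t).mono le_sup_left).prodMk
    ((isSimpleMeasurable_of_finite (lead t)).mono le_sup_right)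

variable [IsProbabilityMeasure μ]

/-- The current reward is independent of past, leader and arm, hence factors out as `r b`; the
choice of arm is then replaced by its conditional probability. -/
theorem integral_mul_played_mul_reward (h : IsSamba μ r α p0 R arm lead p) (t : ℕ) (b : A)
    {X : Ω → ℝ} (hX : IsSimpleMeasurable
      (history R arm lead t ⊔ MeasurableSpace.comap (lead t) inferInstance) X) :
    ∫ ω, X ω * played arm b t ω * R t b ω ∂μ = r b * ∫ ω, X ω * p t ω b ∂μ := by
  have hpl : IsSimpleMeasurable (MeasurableSpace.comap (arm t) inferInstance)
      (played arm b t) :=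
    (isSimpleMeasurable_of_finite (arm t)).comp fun a => if a = b then (1 : ℝ) else 0
  have hXp := (hX.mono (le_sup_left (b := MeasurableSpace.comap (arm t) inferInstance))).mul
    (hpl.mono le_sup_right)
  have hind : IndepFun (fun ω => X ω * played arm b t ω) (R t b) μ := by
    refine (indep_of_indep_of_le_left (indep_of_indep_of_le_right (h.reward_indep_choice t)
      hXp.measurable.comap_le) (?_ : MeasurableSpace.comap (R t b) _ ≤ _)).symm
    exact ((measurable_pi_apply b).comp (comap_measurable (fun ω a => R t a ω))).comap_le
  have hle := sup_le (h.history_lead_le t) (h.measurable_arm t).comap_le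
  rw [hind.integral_fun_mul_eq_mul_integral (hXp.mono hle).measurable.aestronglyMeasurable
    (h.measurable_reward t b).aestronglyMeasurable, h.integral_reward, mul_comm]
  congr 1
  exact hX.integral_mul_of_condExp (h.history_lead_le t)
    (hpl.integrable (h.measurable_arm t).comap_le) (h.arm_law t b)

/-- The conditional expectation of `f (p (t + 1))` given past and leader, in weak form: `X` plays
the role of a test variable. -/
theorem integral_apply_succ (h : IsSamba μ r α p0 R arm lead p)
    (hα : ∀ x, 0 < x → x ≤ 1 → α x ∈ Set.Ioc 0 (1 / 2))
    (hp0 : ∀ a, 0 < p0 a) (hp1 : ∑ a, p0 a = 1) (t : ℕ) {X : Ω → ℝ}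
    (hX : IsSimpleMeasurable (history R arm lead t) X) (f : (A → ℝ) → ℝ) :
    ∫ ω, X ω * f (p (t + 1) ω) ∂μ
      = ∫ ω, X ω * (f (p t ω) + sambaDrift r α (p t ω) (lead t ω) f) ∂μ := by
  have hle := h.history_lead_le t
  have hX' := hX.mono (le_sup_left (b := MeasurableSpace.comap (lead t) inferInstance))
  have hW : ∀ b, IsSimpleMeasurable
      (history R arm lead t ⊔ MeasurableSpace.comap (lead t) inferInstance)
      (fun ω => X ω * (f (rewardUpdate α (p t ω) (lead t ω) b) - f (p t ω))) := fun b =>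
    hX'.mul ((h.isSimpleMeasurable_lead t).comp
      fun x => f (rewardUpdate α x.1 x.2 b) - f x.1)
  have hf : Integrable (fun ω => X ω * f (p t ω)) μ :=
    (hX.mul ((h.isSimpleMeasurable t).comp f)).integrable (h.history_le t)
  have hpb : ∀ b, IsSimpleMeasurable
      (history R arm lead t ⊔ MeasurableSpace.comap (lead t) inferInstance) fun ω => p t ω b :=
    fun b => ((h.isSimpleMeasurable t).comp fun q => q b).mono le_sup_left
  have hR : ∀ b, IsSimpleMeasurable mΩ (fun ω => played arm b t ω * R t b ω) := fun b =>
    (((h.isSimpleMeasurable_played t).comp fun y => y b).mono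
      (le_sup_right.trans (comap_le_history (R := R) (arm := arm) (lead := lead)
        (Nat.lt_succ_self t)))).mono (h.history_le (t + 1))
  have e1 : ∀ ω, X ω * f (p (t + 1) ω) = X ω * f (p t ω)
      + ∑ b, X ω * (f (rewardUpdate α (p t ω) (lead t ω) b) - f (p t ω)) *
        played arm b t ω * R t b ω := fun ω => by
    rw [h.apply_step (h.simplex hα hp0 hp1 t ω).2 f, mul_add, Finset.mul_sum]
    simp only [mul_assoc]
  have e2 : ∀ ω, X ω * (f (p t ω) + sambaDrift r α (p t ω) (lead t ω) f) = X ω * f (p t ω)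
      + ∑ b, r b * (X ω * (f (rewardUpdate α (p t ω) (lead t ω) b) - f (p t ω)) * p t ω b) :=
    fun ω => by
    rw [mul_add, sambaDrift, Finset.mul_sum]
    congr 1
    exact Finset.sum_congr rfl fun b _ => by ring
  simp only [e1, e2]
  have i1 : ∀ b, Integrable (fun ω => X ω * (f (rewardUpdate α (p t ω) (lead t ω) b)
      - f (p t ω)) * played arm b t ω * R t b ω) μ := fun b => by
    simp only [mul_assoc]
    simpa only [mul_assoc] using (((hW b).mono hle).mul (hR b)).integrable le_rfl
  have i2 : ∀ b, Integrable (fun ω => r b * (X ω * (f (rewardUpdate α (p t ω) (lead t ω) b)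
      - f (p t ω)) * p t ω b)) μ := fun b =>
    (((hW b).mul (hpb b)).integrable hle).const_mul _
  rw [integral_add hf (integrable_finsetSum _ fun b _ => i1 b),
    integral_add hf (integrable_finsetSum _ fun b _ => i2 b),
    integral_finsetSum _ fun b _ => i1 b, integral_finsetSum _ fun b _ => i2 b]
  congr 1
  refine Finset.sum_congr rfl fun b _ => ?_
  rw [h.integral_mul_played_mul_reward t b (hW b), integral_const_mul]

theorem integral_lead (h : IsSamba μ r α p0 R arm lead p) (t : ℕ) {X : Ω → ℝ}
    (hX : IsSimpleMeasurable (history R arm lead t) X) (g : (A → ℝ) → A → ℝ) :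
    ∫ ω, X ω * g (p t ω) (lead t ω) ∂μ
      = ∫ ω, X ω * ∑ a, (if a ∈ maximizers (p t ω) then 1 / ((maximizers (p t ω)).card : ℝ)
          else 0) * g (p t ω) a ∂μ := by
  have hg : ∀ a, IsSimpleMeasurable (history R arm lead t) fun ω => X ω * g (p t ω) a :=
    fun a => hX.mul ((h.isSimpleMeasurable t).comp fun q => g q a)
  have hw : ∀ a, IsSimpleMeasurable (history R arm lead t) fun ω =>
      if a ∈ maximizers (p t ω) then 1 / ((maximizers (p t ω)).card : ℝ) else 0 := fun a =>
    (h.isSimpleMeasurable t).comp fun q =>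
      if a ∈ maximizers q then 1 / ((maximizers q).card : ℝ) else 0
  have hl : ∀ a, IsSimpleMeasurable mΩ fun ω => if lead t ω = a then (1 : ℝ) else 0 := fun a =>
    ((isSimpleMeasurable_of_finite (lead t)).mono (h.measurable_lead t).comap_le).comp
      fun b => if b = a then (1 : ℝ) else 0
  have e1 : ∀ ω, X ω * g (p t ω) (lead t ω)
      = ∑ a, X ω * g (p t ω) a * (if lead t ω = a then (1 : ℝ) else 0) := fun ω => by simp
  simp only [e1, Finset.mul_sum]
  rw [integral_finsetSum _ fun a _ =>
      (((hg a).mono (h.history_le t)).mul (hl a)).integrable le_rfl,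
    integral_finsetSum _ fun a _ => ?_]
  · refine Finset.sum_congr rfl fun a _ => ?_
    rw [(hg a).integral_mul_of_condExp (h.history_le t) ((hl a).integrable le_rfl)
      (h.lead_law t a)]
    exact integral_congr_ae (Eventually.of_forall fun ω => by ring)
  · have := ((hg a).mul (hw a)).integrable (μ := μ) (h.history_le t)
    refine this.congr (Eventually.of_forall fun ω => ?_)
    simp only
    ring

end IsSamba

end Bandit

/-! ### The transition kernel. -/

section Kernel

variable {A : Type*} [Fintype A] [DecidableEq A]

/-- The law of the SAMBA state after one step from `q`. -/
noncomputable def sambaStepLaw (r : A → ℝ) (α : ℝ → ℝ) (q : A → ℝ) : Measure (A → ℝ) :=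
  ∑ a, ENNReal.ofReal (if a ∈ maximizers q then 1 / ((maximizers q).card : ℝ) else 0) •
    ∑ b, (ENNReal.ofReal (q b * r b) • Measure.dirac (rewardUpdate α q a b) +
      ENNReal.ofReal (q b * (1 - r b)) • Measure.dirac q)

/-- Puts the kernel in the form of an indicator plus its drift, averaged over leaders, to match
`integral_apply_succ` followed by `integral_lead`. -/
theorem sambaStepLaw_real {r : A → ℝ} (hr : ∀ a, r a ∈ Set.Icc (0 : ℝ) 1) (α : ℝ → ℝ)
    {q : A → ℝ} (hpos : ∀ a, 0 < q a) (hq : ∑ a, q a = 1) {S : Set (A → ℝ)}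
    (hS : MeasurableSet S) :
    (sambaStepLaw r α q).real S
      = ∑ a, (if a ∈ maximizers q then 1 / ((maximizers q).card : ℝ) else 0) *
        (S.indicator (fun _ => (1 : ℝ)) q
          + sambaDrift r α q a (S.indicator fun _ => (1 : ℝ))) := by
  have hd : ∀ x : A → ℝ, Measure.dirac x S = ENNReal.ofReal (S.indicator (fun _ => (1 : ℝ)) x) :=
    fun x => by
      rw [Measure.dirac_apply' _ hS]
      by_cases hx : x ∈ S <;> simp [hx]
  have hi : ∀ x : A → ℝ, 0 ≤ S.indicator (fun _ => (1 : ℝ)) x := fun x =>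
    Set.indicator_nonneg (fun _ _ => zero_le_one) x
  have hw : ∀ a, 0 ≤ (if a ∈ maximizers q then 1 / ((maximizers q).card : ℝ) else 0) := fun a => by
    split_ifs <;> positivity
  have hb1 : ∀ b, 0 ≤ q b * r b := fun b => mul_nonneg (hpos b).le (hr b).1
  have hb2 : ∀ b, 0 ≤ q b * (1 - r b) := fun b =>
    mul_nonneg (hpos b).le (by linarith [(hr b).2])
  have key : ∀ a, 0 ≤ ∑ b, (q b * r b * S.indicator (fun _ => (1 : ℝ)) (rewardUpdate α q a b)
      + q b * (1 - r b) * S.indicator (fun _ => (1 : ℝ)) q) := fun a =>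
    Finset.sum_nonneg fun b _ => add_nonneg (mul_nonneg (hb1 b) (hi _)) (mul_nonneg (hb2 b) (hi _))
  have e : sambaStepLaw r α q S = ENNReal.ofReal
      (∑ a, (if a ∈ maximizers q then 1 / ((maximizers q).card : ℝ) else 0) *
        ∑ b, (q b * r b * S.indicator (fun _ => (1 : ℝ)) (rewardUpdate α q a b)
          + q b * (1 - r b) * S.indicator (fun _ => (1 : ℝ)) q)) := by
    rw [ENNReal.ofReal_sum_of_nonneg fun a _ => mul_nonneg (hw a) (key a)]
    unfold sambaStepLaw
    rw [Measure.finsetSum_apply]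
    refine Finset.sum_congr rfl fun a _ => ?_
    rw [ENNReal.ofReal_mul (hw a), Measure.smul_apply, smul_eq_mul, Measure.finsetSum_apply,
      ENNReal.ofReal_sum_of_nonneg fun b _ =>
        add_nonneg (mul_nonneg (hb1 b) (hi _)) (mul_nonneg (hb2 b) (hi _))]
    congr 1
    refine Finset.sum_congr rfl fun b _ => ?_
    rw [ENNReal.ofReal_add (mul_nonneg (hb1 b) (hi _)) (mul_nonneg (hb2 b) (hi _)),
      ENNReal.ofReal_mul (hb1 b), ENNReal.ofReal_mul (hb2 b), ← hd, ← hd]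
    simp
  rw [measureReal_def, e, ENNReal.toReal_ofReal
    (Finset.sum_nonneg fun a _ => mul_nonneg (hw a) (key a))]
  refine Finset.sum_congr rfl fun a _ => ?_
  congr 1
  have e2 : S.indicator (fun _ => (1 : ℝ)) q = ∑ b, q b * S.indicator (fun _ => (1 : ℝ)) q := by
    rw [← Finset.sum_mul, hq, one_mul]
  refine Eq.trans ?_ (congrArg (· + sambaDrift r α q a (S.indicator fun _ => (1 : ℝ))) e2.symm)
  rw [sambaDrift, ← Finset.sum_add_distrib]
  exact Finset.sum_congr rfl fun b _ => by ring

theorem isProbabilityMeasure_sambaStepLaw [Nonempty A] {r : A → ℝ}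
    (hr : ∀ a, r a ∈ Set.Icc (0 : ℝ) 1) (α : ℝ → ℝ)
    {q : A → ℝ} (hpos : ∀ a, 0 < q a) (hq : ∑ a, q a = 1) :
    IsProbabilityMeasure (sambaStepLaw r α q) := by
  have hne : (maximizers q).Nonempty := by
    obtain ⟨a, ha⟩ := Finite.exists_max q
    exact ⟨a, by simpa [maximizers] using ha⟩
  have h := sambaStepLaw_real hr α hpos hq (S := Set.univ) MeasurableSet.univ
  have hc : ((maximizers q).card : ℝ) ≠ 0 := by exact_mod_cast hne.card_pos.ne'
  have h1 : (sambaStepLaw r α q).real Set.univ = 1 := by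
    rw [h]
    simp [sambaDrift, hc]
  rw [measureReal_def, ENNReal.toReal_eq_one_iff] at h1
  exact ⟨h1⟩

end Kernel

/-- Redefined as a fixed Dirac mass off `D`, the map differs from a constant only on a countable
set, so it is measurable whatever `K` is. The reachable states form such a set. -/
theorem exists_markovKernel_of_countable {E : Type*} [MeasurableSpace E]
    [MeasurableSingletonClass E] [Nonempty E] {D : Set E} (hD : D.Countable) (K : E → Measure E)
    (hK : ∀ x ∈ D, IsProbabilityMeasure (K x)) :
    ∃ κ : Kernel E E, IsMarkovKernel κ ∧ ∀ x ∈ D, κ x = K x := by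
  classical
  obtain ⟨x0⟩ := ‹Nonempty E›
  have hm : Measurable fun x => if x ∈ D then K x else Measure.dirac x0 :=
    (measurable_const (a := Measure.dirac x0)).measurable_of_countable_ne
      (hD.mono fun x hx => by by_contra h; simp [h] at hx)
  refine ⟨⟨_, hm⟩, ⟨fun x => ?_⟩, fun x hx => ?_⟩
  · change IsProbabilityMeasure (if x ∈ D then K x else Measure.dirac x0)
    split_ifs with hx
    · exact hK x hx
    · infer_instance
  · change (if x ∈ D then K x else Measure.dirac x0) = K x
    rw [if_pos hx]

/-- The information carried by the process `X` up to time `t`. -/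
abbrev naturalHistory {Ω E : Type*} [MeasurableSpace E] (X : ℕ → Ω → E) (t : ℕ) :
    MeasurableSpace Ω :=
  ⨆ s ∈ Set.Iic t, MeasurableSpace.comap (X s) inferInstance

/-! ### Almost sure convergence, the Markov property and the regret decomposition. -/

namespace IsSamba

variable {A Ω : Type*} [Fintype A] [DecidableEq A] [MeasurableSpace A]
  [mΩ : MeasurableSpace Ω] {μ : Measure Ω} {r : A → ℝ} {α : ℝ → ℝ} {p0 : A → ℝ}
  {R : ℕ → A → Ω → ℝ} {arm lead : ℕ → Ω → A} {p : ℕ → Ω → A → ℝ}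

theorem ae_tendsto_one [IsProbabilityMeasure μ] (h : IsSamba μ r α p0 R arm lead p)
    (hα : ∀ x, 0 < x → x ≤ 1 → α x ∈ Set.Ioc 0 (1 / 2))
    (hp0 : ∀ a, 0 < p0 a) (hp1 : ∑ a, p0 a = 1) {s : A}
    (hsum : ∀ ε, 0 < ε → ε ≤ 1 / 2 → Summable fun t => μ.real {ω | p t ω s ≤ 1 - ε}) :
    ∀ᵐ ω ∂μ, Tendsto (fun t => p t ω s) atTop (𝓝 1) := by
  -- Borel–Cantelli along `ε = 1/(k + 2)`; the `2` keeps `ε ≤ 1/2`.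
  have key : ∀ k : ℕ, ∀ᵐ ω ∂μ, ∀ᶠ t in atTop, ω ∉ {ω | p t ω s ≤ 1 - 1 / ((k : ℝ) + 2)} := by
    intro k
    apply ae_eventually_notMem
    have h1 := (hsum (1 / ((k : ℝ) + 2)) (by positivity)
      (one_div_le_one_div_of_le two_pos (by linarith [k.cast_nonneg (α := ℝ)]))).tsum_ofReal_ne_top
    rwa [tsum_congr fun t => ofReal_measureReal (μ := μ)] at h1
  filter_upwards [ae_all_iff.2 key] with ω hω
  refine tendsto_order.2 ⟨fun a ha => ?_, fun a ha => ?_⟩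
  · obtain ⟨k, hk⟩ := exists_nat_one_div_lt (sub_pos.2 ha)
    filter_upwards [hω k] with t ht
    have ht' : 1 - 1 / ((k : ℝ) + 2) < p t ω s := not_le.1 ht
    have : 1 / ((k : ℝ) + 2) ≤ 1 / ((k : ℝ) + 1) :=
      one_div_le_one_div_of_le (by positivity) (by linarith)
    linarith
  · exact Eventually.of_forall fun t =>
      (apply_le_one (h.simplex hα hp0 hp1 t ω).1 (h.simplex hα hp0 hp1 t ω).2 s).trans_lt ha

variable [MeasurableSingletonClass A]

theorem measurableSet_preimage (h : IsSamba μ r α p0 R arm lead p) (t : ℕ) (S : Set (A → ℝ)) :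
    MeasurableSet (p t ⁻¹' S) :=
  h.history_le t _ ((h.isSimpleMeasurable t).2 S)

theorem integral_ite_le (h : IsSamba μ r α p0 R arm lead p) (t : ℕ) (s : A) (x : ℝ) :
    ∫ ω, (if p t ω s ≤ x then (1 : ℝ) else 0) ∂μ = μ.real {ω | p t ω s ≤ x} := by
  have hm : MeasurableSet {ω | p t ω s ≤ x} := h.measurableSet_preimage t {q | q s ≤ x}
  have e : (fun ω => if p t ω s ≤ x then (1 : ℝ) else 0)
      = {ω | p t ω s ≤ x}.indicator fun _ => (1 : ℝ) := by
    funext ω; simp [Set.indicator]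
  rw [e, integral_indicator_const _ hm]
  simp

variable [IsProbabilityMeasure μ]

theorem isMarkovChain [Nonempty A] (h : IsSamba μ r α p0 R arm lead p)
    (hr : ∀ a, r a ∈ Set.Icc (0 : ℝ) 1)
    (hα : ∀ x, 0 < x → x ≤ 1 → α x ∈ Set.Ioc 0 (1 / 2))
    (hp0 : ∀ a, 0 < p0 a) (hp1 : ∑ a, p0 a = 1) : IsMarkovChain μ p := by
  have hpm : ∀ t, Measurable (p t) := fun t =>
    ((h.isSimpleMeasurable t).mono (h.history_le t)).measurable
  have hsx := h.simplex hα hp0 hp1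
  obtain ⟨κ, hκ, hκeq⟩ := exists_markovKernel_of_countable
    (D := ⋃ t, Set.range (p t)) (Set.countable_iUnion fun t => (h.isSimpleMeasurable t).1.countable)
    (sambaStepLaw r α) (fun x hx => by
      obtain ⟨t, ω, rfl⟩ := Set.mem_iUnion.1 hx
      exact isProbabilityMeasure_sambaStepLaw hr α (hsx t ω).1 (hsx t ω).2)
  refine ⟨hpm, κ, hκ, fun t S hS => ?_⟩
  change μ[_ | naturalHistory p t] =ᵐ[μ] _
  -- The identities hold against events of the finer bandit history; the kernel depends on `p t`
  -- alone, so they descend to the natural filtration.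
  have hmh : naturalHistory p t ≤ history R arm lead t := iSup₂_le fun s hs =>
    ((h.isSimpleMeasurable s).mono (history_mono hs)).measurable.comap_le
  have hm := hmh.trans (h.history_le t)
  have hpt : Measurable[naturalHistory p t] (p t) := Measurable.mono (comap_measurable (p t))
    (le_biSup (fun s => MeasurableSpace.comap (p s) inferInstance) (Set.mem_Iic.2 le_rfl)) le_rfl
  have hκm : Measurable fun x => (κ x).real S := (κ.measurable_coe hS).ennreal_toReal
  have hκp : StronglyMeasurable[naturalHistory p t] fun ω => (κ (p t ω)).real S :=
    (hκm.comp hpt).stronglyMeasurable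
  refine (ae_eq_condExp_of_forall_setIntegral_eq hm ?_ ?_ ?_ hκp.aestronglyMeasurable).symm
  · exact (integrable_const 1).indicator (hpm (t + 1) hS)
  · intro H _ _
    refine (Integrable.of_bound (hκp.mono hm).aestronglyMeasurable 1
      (Eventually.of_forall fun ω => ?_)).integrableOn
    rw [Real.norm_of_nonneg measureReal_nonneg]
    exact measureReal_le_one
  · intro H hH _
    have hHm := hm _ hH
    have hX := IsSimpleMeasurable.indicator_one (hmh _ hH)
    have hset : ∀ g : Ω → ℝ, ∫ ω in H, g ω ∂μ = ∫ ω, H.indicator (fun _ => (1 : ℝ)) ω * g ω ∂μ :=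
      fun g => by
        rw [← integral_indicator hHm]
        refine integral_congr_ae (Eventually.of_forall fun ω => ?_)
        by_cases hω : ω ∈ H <;> simp [hω]
    rw [hset, hset]
    have e := h.integral_apply_succ hα hp0 hp1 t hX (S.indicator fun _ => (1 : ℝ))
    have e2 := h.integral_lead t hX fun q a => S.indicator (fun _ => (1 : ℝ)) q
      + sambaDrift r α q a (S.indicator fun _ => (1 : ℝ))
    refine (e.trans (e2.trans ?_)).symm
    refine integral_congr_ae (Eventually.of_forall fun ω => ?_)
    beta_reduce
    rw [hκeq (p t ω) (Set.mem_iUnion.2 ⟨t, ω, rfl⟩),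
      sambaStepLaw_real hr α (hsx t ω).1 (hsx t ω).2 hS]

theorem integrable_comp (h : IsSamba μ r α p0 R arm lead p) (t : ℕ) (f : (A → ℝ) → ℝ) :
    Integrable (fun ω => f (p t ω)) μ :=
  ((h.isSimpleMeasurable t).comp f).integrable (h.history_le t)

/-- A potential whose drift is at most `-g` bounds the accumulated expectation of `g`. -/
theorem sum_integral_le_of_drift (h : IsSamba μ r α p0 R arm lead p)
    (hα : ∀ x, 0 < x → x ≤ 1 → α x ∈ Set.Ioc 0 (1 / 2))
    (hp0 : ∀ a, 0 < p0 a) (hp1 : ∑ a, p0 a = 1) {V g : (A → ℝ) → ℝ}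
    (hV : ∀ (q : A → ℝ) (lead : A), (∀ a, 0 < q a) → ∑ a, q a = 1 → (∀ b, q b ≤ q lead) →
      g q ≤ -sambaDrift r α q lead V) (T : ℕ) :
    ∑ t ∈ Finset.range T, ∫ ω, g (p t ω) ∂μ ≤ V p0 - ∫ ω, V (p T ω) ∂μ := by
  induction T with
  | zero => simp [h.init]
  | succ T ih =>
    rw [Finset.sum_range_succ]
    have e := h.integral_apply_succ hα hp0 hp1 T
      (IsSimpleMeasurable.indicator_one MeasurableSet.univ) V
    simp only [Set.indicator_univ, one_mul] at e
    have hD : Integrable (fun ω => sambaDrift r α (p T ω) (lead T ω) V) μ :=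
      ((h.isSimpleMeasurable_lead T).comp fun x => sambaDrift r α x.1 x.2 V).integrable
        (h.history_lead_le T)
    rw [integral_add (h.integrable_comp T V) hD] at e
    have h1 : ∫ ω, g (p T ω) ∂μ ≤ ∫ ω, -sambaDrift r α (p T ω) (lead T ω) V ∂μ := by
      refine integral_mono (h.integrable_comp T g) hD.neg fun ω => ?_
      have hs := h.simplex hα hp0 hp1 T ω
      exact hV _ _ hs.1 hs.2 (by simpa [maximizers] using h.lead_mem T ω)
    rw [integral_neg] at h1
    linarith

theorem summable_measureReal_le [Nonempty A] (h : IsSamba μ r α p0 R arm lead p)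
    (hr : ∀ a, r a ∈ Set.Icc (0 : ℝ) 1)
    {Δ : ℝ} (hΔ : 0 < Δ) {s : A} (hgap : ∀ a, a ≠ s → r a ≤ r s - Δ)
    (hα : ∀ x, 0 < x → x ≤ 1 → α x ∈ Set.Ioc 0 (1 / 2))
    {k : ℝ} (hk : 0 < k) (hαk : ∀ x, 0 < x → x ≤ 1 → k * x ≤ α x)
    {x0 : ℝ} (hx0 : 0 < x0) (hαx0 : ∀ x, 0 < x → x < x0 → α x ≤ Δ / 16)
    (hp0 : ∀ a, 0 < p0 a) (hp1 : ∑ a, p0 a = 1) {ε : ℝ} (hε : 0 < ε) (hε2 : ε ≤ 1 / 2) :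
    Summable fun t => μ.real {ω | p t ω s ≤ 1 - ε} := by
  obtain ⟨K, hK, hV⟩ := exists_lyapunov hr hΔ hgap hα hk hαk hx0 hαx0
  obtain ⟨c, hc, hV⟩ := hV ε hε hε2
  refine summable_of_sum_range_le (c := ((p0 s ^ 2)⁻¹ + K * (1 - p0 s)) / c)
    (fun _ => measureReal_nonneg) fun T => ?_
  have h1 := h.sum_integral_le_of_drift hα hp0 hp1
    (V := fun q => (q s ^ 2)⁻¹ + K * (1 - q s)) (g := fun q => c * if q s ≤ 1 - ε then 1 else 0)
    (fun q lead h1 h2 h3 => by linarith [hV q lead h1 h2 h3]) T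
  simp only [integral_const_mul, h.integral_ite_le, ← Finset.mul_sum] at h1
  have h2 : 0 ≤ ∫ ω, ((p T ω s ^ 2)⁻¹ + K * (1 - p T ω s)) ∂μ := integral_nonneg fun ω => by
    have hs := h.simplex hα hp0 hp1 T ω
    have := apply_le_one hs.1 hs.2 s
    have : 0 ≤ K * (1 - p T ω s) := mul_nonneg hK (by linarith)
    positivity
  rw [le_div_iff₀ hc, mul_comm]
  linarith

theorem integral_played_mul_reward (h : IsSamba μ r α p0 R arm lead p) (t : ℕ) (a : A) :
    Integrable (fun ω => played arm a t ω * R t a ω) μ ∧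
      ∫ ω, played arm a t ω * R t a ω ∂μ = r a * ∫ ω, p t ω a ∂μ := by
  constructor
  · exact ((h.isSimpleMeasurable_played t).comp fun y => y a).integrable
      ((le_sup_right.trans (comap_le_history (R := R) (arm := arm) (lead := lead)
        (Nat.lt_succ_self t))).trans (h.history_le (t + 1)))
  · have := h.integral_mul_played_mul_reward t a
      (IsSimpleMeasurable.indicator_one MeasurableSet.univ)
    simpa using this

/-- Rewards of suboptimal arms are discarded and `r s ≤ 1` is used, leaving the expected number of
plays of other arms. -/
theorem regret_le (h : IsSamba μ r α p0 R arm lead p)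
    (hr : ∀ a, r a ∈ Set.Icc (0 : ℝ) 1)
    (hα : ∀ x, 0 < x → x ≤ 1 → α x ∈ Set.Ioc 0 (1 / 2))
    (hp0 : ∀ a, 0 < p0 a) (hp1 : ∑ a, p0 a = 1) (s : A) (T : ℕ) :
    regret μ r s R arm T ≤ ∑ t ∈ Finset.range T, ∫ ω, (1 - p t ω s) ∂μ := by
  have i1 : ∀ t, Integrable (fun ω => ∑ a, played arm a t ω * R t a ω) μ := fun t =>
    integrable_finsetSum _ fun a _ => (h.integral_played_mul_reward t a).1
  unfold regret
  rw [integral_finsetSum _ fun t _ => i1 t]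
  have e : r s * T = ∑ t ∈ Finset.range T, r s := by simp [mul_comm]
  rw [e, ← Finset.sum_sub_distrib]
  refine Finset.sum_le_sum fun t _ => ?_
  rw [integral_finsetSum _ fun a _ => (h.integral_played_mul_reward t a).1]
  simp only [fun a => (h.integral_played_mul_reward t a).2, ← integral_const_mul]
  rw [← integral_finsetSum _ fun a _ => (h.integrable_comp t fun q => q a).const_mul _]
  have e2 : r s = ∫ _ : Ω, r s ∂μ := by simp
  rw [e2, ← integral_sub (integrable_const _)
    (integrable_finsetSum _ fun a _ => (h.integrable_comp t fun q => q a).const_mul _)]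
  refine integral_mono ((integrable_const _).sub
    (integrable_finsetSum _ fun a _ => (h.integrable_comp t fun q => q a).const_mul _))
    ((integrable_const _).sub (h.integrable_comp t fun q => q s)) fun ω => ?_
  have hs := h.simplex hα hp0 hp1 t ω
  have h1 : r s * p t ω s ≤ ∑ a, r a * p t ω a :=
    Finset.single_le_sum (f := fun a => r a * p t ω a)
      (fun a _ => mul_nonneg (hr a).1 (hs.1 a).le) (Finset.mem_univ s)
  have h2 : r s * (1 - p t ω s) ≤ 1 - p t ω s :=
    mul_le_of_le_one_left (by linarith [apply_le_one hs.1 hs.2 s]) (hr s).2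
  change r s - ∑ a, r a * p t ω a ≤ 1 - p t ω s
  linarith

theorem sum_integral_one_sub_le [Nontrivial A] (h : IsSamba μ r α p0 R arm lead p)
    (hr : ∀ a, r a ∈ Set.Icc (0 : ℝ) 1)
    {Δ : ℝ} (hΔ : 0 < Δ) {s : A} (hgap : ∀ a, a ≠ s → r a ≤ r s - Δ)
    (hα : ∀ x, 0 < x → x ≤ 1 → α x ∈ Set.Ioc 0 (1 / 2))
    {δ m : ℝ} (hδ : 0 < δ) (hm : 0 < m)
    (hαm : ∀ x, δ / (Fintype.card A - 1) ≤ x → x ≤ 1 → m ≤ α x)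
    (hp0 : ∀ a, 0 < p0 a) (hp1 : ∑ a, p0 a = 1) (T : ℕ) :
    ∑ t ∈ Finset.range T, ∫ ω, (1 - p t ω s) ∂μ
      ≤ ∑ t ∈ Finset.range T, μ.real {ω | p t ω s ≤ 1 / 2}
        + ((Fintype.card A - 1) / (Δ * m)) * Real.log (1 + δ⁻¹) + 3 * δ * T := by
  have hn : (0 : ℝ) < Fintype.card A - 1 := by
    have : (1 : ℝ) < Fintype.card A := by exact_mod_cast Fintype.one_lt_card
    linarith
  set K := ((Fintype.card A : ℝ) - 1) / (Δ * m) with hK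
  have hK0 : 0 < K := by positivity
  have h1 := h.sum_integral_le_of_drift hα hp0 hp1
    (V := fun q => Real.log (1 - q s + δ))
    (g := fun q => K⁻¹ * if q s ≤ 1 / 2 then 0 else 1 - q s - 3 * δ)
    (fun q lead h1 h2 h3 => by
      have := sub_le_neg_sambaDrift_log hr hΔ hgap hα hδ hm hαm h1 h2 h3
      rw [inv_mul_le_iff₀ hK0]
      linarith) T
  have h2 : Real.log (1 - p0 s + δ) ≤ Real.log (1 + δ) :=
    Real.log_le_log (by linarith [apply_le_one hp0 hp1 s]) (by linarith [hp0 s])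
  have h3 : Real.log δ ≤ ∫ ω, Real.log (1 - p T ω s + δ) ∂μ := by
    have e : Real.log δ = ∫ _ : Ω, Real.log δ ∂μ := by simp
    rw [e]
    refine integral_mono (integrable_const _)
      (h.integrable_comp T fun q => Real.log (1 - q s + δ)) fun ω => ?_
    have hs := h.simplex hα hp0 hp1 T ω
    exact Real.log_le_log hδ (by linarith [apply_le_one hs.1 hs.2 s])
  have h4 : Real.log (1 + δ) - Real.log δ = Real.log (1 + δ⁻¹) := by
    rw [← Real.log_div (by linarith) hδ.ne', add_div, div_self hδ.ne', one_div, add_comm]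
  simp only [integral_const_mul, ← Finset.mul_sum] at h1
  rw [inv_mul_le_iff₀ hK0] at h1
  -- Pointwise split: the indicator of `p s ≤ 1/2` feeds `Q`, the second term is controlled by the
  -- logarithmic drift, and `3δ` is the truncation error.
  have h5 : ∑ t ∈ Finset.range T, ∫ ω, (1 - p t ω s) ∂μ
      ≤ ∑ t ∈ Finset.range T, (μ.real {ω | p t ω s ≤ 1 / 2}
        + ∫ ω, (if p t ω s ≤ 1 / 2 then 0 else 1 - p t ω s - 3 * δ) ∂μ + 3 * δ) := by
    refine Finset.sum_le_sum fun t _ => ?_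
    have e : 3 * δ = ∫ _ : Ω, 3 * δ ∂μ := by simp
    have i1 := h.integrable_comp t fun q => if q s ≤ 1 / 2 then (1 : ℝ) else 0
    have i2 := h.integrable_comp t fun q => if q s ≤ 1 / 2 then (0 : ℝ) else 1 - q s - 3 * δ
    calc ∫ ω, (1 - p t ω s) ∂μ
        ≤ ∫ ω, ((if p t ω s ≤ 1 / 2 then (1 : ℝ) else 0)
          + (if p t ω s ≤ 1 / 2 then (0 : ℝ) else 1 - p t ω s - 3 * δ) + 3 * δ) ∂μ := by
          refine integral_mono ((integrable_const _).sub (h.integrable_comp t fun q => q s))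
            ((i1.add i2).add (integrable_const _)) fun ω => ?_
          have hs := (h.simplex hα hp0 hp1 t ω).1 s
          change 1 - p t ω s ≤ (if p t ω s ≤ 1 / 2 then (1 : ℝ) else 0)
            + (if p t ω s ≤ 1 / 2 then (0 : ℝ) else 1 - p t ω s - 3 * δ) + 3 * δ
          split_ifs <;> linarith
      _ = _ := by
          refine (integral_add (i1.add i2) (integrable_const _)).trans ?_
          rw [← e]
          exact congrArg (· + 3 * δ) ((integral_add i1 i2).trans (by rw [h.integral_ite_le]))
  rw [Finset.sum_add_distrib, Finset.sum_add_distrib, Finset.sum_const, Finset.card_range,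
    nsmul_eq_mul] at h5
  have h6 : K * (Real.log (1 - p0 s + δ) - ∫ ω, Real.log (1 - p T ω s + δ) ∂μ)
      ≤ K * Real.log (1 + δ⁻¹) := mul_le_mul_of_nonneg_left (by linarith) hK0.le
  linarith

end IsSamba

/-! ### The gap and the choice of constants. -/

theorem gap_le_sub {A : Type*} [Finite A] (r : A → ℝ) (s a : A) (ha : a ≠ s) :
    r a ≤ r s - gap r s := by
  have := le_ciSup (Set.finite_range fun a : {a : A // a ≠ s} => r a).bddAbove ⟨a, ha⟩
  unfold gap
  simp only at this
  linarith

theorem gap_pos {A : Type*} [Finite A] [Nontrivial A] {r : A → ℝ} {s : A}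
    (h : ∀ a, a ≠ s → r a < r s) : 0 < gap r s := by
  obtain ⟨a, ha⟩ := exists_ne s
  have : Nonempty {a : A // a ≠ s} := ⟨⟨a, ha⟩⟩
  obtain ⟨b, hb⟩ := Finite.exists_max fun a : {a : A // a ≠ s} => r a
  have h1 : (⨆ a : {a : A // a ≠ s}, r a) ≤ r b := ciSup_le hb
  unfold gap
  linarith [h b b.2]

theorem log_one_add_natCast_le {T : ℕ} (hT : 2 ≤ T) :
    Real.log (1 + (T : ℝ)) ≤ 2 * Real.log T := by
  have hT' : (2 : ℝ) ≤ T := by exact_mod_cast hT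
  have e : 2 * Real.log T = Real.log ((T : ℝ) ^ 2) := by rw [Real.log_pow]; norm_num
  rw [e]
  exact Real.log_le_log (by linarith) (by nlinarith)

theorem theorem4 (l : ℝ → ℝ) (hrange : ∀ u, 0 < u → l u ∈ Set.Icc (0 : ℝ) 1)
    (hmono : MonotoneOn l (Set.Ioi 0)) (hslow : SlowlyVaryingAtZero l)
    (hlim : Tendsto l (𝓝[>] 0) (𝓝 0)) :
    ∃ C : ℝ, 0 < C ∧
      ∀ (A : Type*) [Fintype A] [DecidableEq A] [Nontrivial A]
        [MeasurableSpace A] [MeasurableSingletonClass A]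
        (r : A → ℝ) (_ : ∀ a, r a ∈ Set.Icc (0 : ℝ) 1)
        (aStar : A) (_ : ∀ a, a ≠ aStar → r a < r aStar)
        (p0 : A → ℝ) (_ : ∀ a, 0 < p0 a) (_ : ∑ a, p0 a = 1)
        (Ω : Type*) [MeasurableSpace Ω] (μ : Measure Ω) [IsProbabilityMeasure μ]
        (R : ℕ → A → Ω → ℝ) (arm lead : ℕ → Ω → A) (p : ℕ → Ω → A → ℝ)
        (_ : IsSamba μ r (learningRate l) p0 R arm lead p),
        IsMarkovChain μ p ∧
        (∀ᵐ ω ∂μ, Tendsto (fun t => p t ω aStar) atTop (𝓝 1)) ∧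
        Summable (fun t => μ.real {ω | p t ω aStar ≤ 1 / 2}) ∧
        ∀ T : ℕ, 1 ≤ T →
          regret μ r aStar R arm T ≤
            C * Fintype.card A / (gap r aStar * l (C / (gap r aStar * T))) * Real.log T
              + ∑' t, μ.real {ω | p t ω aStar ≤ 1 / 2} + 1 := by
  obtain ⟨k, hk, hkl⟩ := hslow.exists_mul_le hmono
  -- `B = 20` is the ratio between `C / (Δ T)`, where the final bound evaluates `l`, and the scale
  -- `w` used in the proof.
  obtain ⟨c, hc, hc1, hcl⟩ := hslow.exists_mul_comp_le hrange hmono (B := 20) (by norm_num)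
  have hlow : ∀ x, 0 < x → l (x / 2) / 8 ≤ learningRate l x := fun x hx =>
    le_learningRate hrange hmono hx
  have hα : ∀ x, 0 < x → x ≤ 1 → learningRate l x ∈ Set.Ioc 0 (1 / 2) := fun x hx _ =>
    ⟨lt_of_lt_of_le (div_pos (hslow.1 _ (half_pos hx)) (by norm_num)) (hlow x hx),
      (learningRate_le hrange hmono hx).trans (by linarith [(hrange x hx).2])⟩
  have hαk : ∀ x, 0 < x → x ≤ 1 → k / 16 * x ≤ learningRate l x := fun x hx hx1 => by
    linarith [hlow x hx, hkl (x / 2) (by linarith) (by linarith)]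
  have hC : 0 < 32 / c := by positivity
  refine ⟨32 / c, hC, ?_⟩
  intro A _ _ _ _ _ r hr s hs p0 hp0 hp1 Ω _ μ _ R arm lead p h
  have hΔ := gap_pos hs
  have hgap := gap_le_sub r s
  have hΔ1 : gap r s ≤ 1 := by
    obtain ⟨a, ha⟩ := exists_ne s
    linarith [hgap a ha, (hr a).1, (hr s).2]
  set Δ := gap r s with hΔdef
  obtain ⟨x0, hx0, hαx0⟩ : ∃ x0, 0 < x0 ∧ ∀ x, 0 < x → x < x0 → learningRate l x ≤ Δ / 16 := by
    have : ∀ᶠ x in 𝓝[>] (0 : ℝ), l x < Δ / 8 := hlim.eventually (gt_mem_nhds (by positivity))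
    obtain ⟨x0, hx0, hx⟩ := mem_nhdsGT_iff_exists_Ioo_subset.1 this
    refine ⟨x0, hx0, fun x h0 h1 => (learningRate_le hrange hmono h0).trans ?_⟩
    have : l x < Δ / 8 := hx ⟨h0, h1⟩
    linarith
  have hsum : ∀ ε, 0 < ε → ε ≤ 1 / 2 → Summable fun t => μ.real {ω | p t ω s ≤ 1 - ε} :=
    fun ε hε hε2 => h.summable_measureReal_le hr hΔ hgap hα (by positivity) hαk hx0 hαx0
      hp0 hp1 hε hε2
  have hQ : Summable fun t => μ.real {ω | p t ω s ≤ 1 / 2} := by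
    have := hsum (1 / 2) (by norm_num) le_rfl
    norm_num at this ⊢
    exact this
  refine ⟨h.isMarkovChain hr hα hp0 hp1, h.ae_tendsto_one hα hp0 hp1 hsum, hQ, fun T hT => ?_⟩
  have hreg := h.regret_le hr hα hp0 hp1 s T
  -- At `T = 1` the logarithm vanishes, and the additive `1` covers the regret.
  rcases hT.eq_or_lt with rfl | hT2
  · have h1 : ∫ ω, (1 - p 0 ω s) ∂μ ≤ 1 := by
      simp only [h.init]
      simp [(hp0 s).le]
    have h2 : 0 ≤ ∑' t, μ.real {ω | p t ω s ≤ 1 / 2} := tsum_nonneg fun _ => measureReal_nonneg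
    rw [Finset.sum_range_one] at hreg
    simp only [Nat.cast_one, Real.log_one, mul_zero]
    linarith
  have hT' : (2 : ℝ) ≤ T := by exact_mod_cast hT2
  have hT0 : (0 : ℝ) < T := by linarith
  set n : ℝ := (Fintype.card A : ℝ) - 1 with hn
  have hn1 : 1 ≤ n := by
    have : (2 : ℝ) ≤ Fintype.card A := by exact_mod_cast Fintype.one_lt_card (α := A)
    linarith
  have hn0 : 0 < n := by linarith
  set C := 32 / c with hCdef
  have hC32 : 32 ≤ C := by rw [hCdef, le_div_iff₀ hc]; linarith
  set w := C / 20 / (Δ * T) with hw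
  have hw0 : 0 < w := by positivity
  -- Makes `δ / n = 2w`, so that `x ≥ δ / n` gives `x / 2 ≥ w` and hence `α x ≥ l w / 8`.
  set δ := 2 * n * w with hδdef
  have hδ : 0 < δ := by positivity
  have hlw : 0 < l w := hslow.1 w hw0
  have hαm : ∀ x, δ / (Fintype.card A - 1) ≤ x → x ≤ 1 → l w / 8 ≤ learningRate l x := by
    intro x hx _
    rw [← hn, div_le_iff₀ hn0] at hx
    have hwx : w ≤ x / 2 := by
      rw [hδdef] at hx
      have : n * (2 * w) ≤ n * x := by linarith
      linarith [le_of_mul_le_mul_left this hn0]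
    have := hmono (Set.mem_Ioi.2 hw0) (Set.mem_Ioi.2 (hw0.trans_le hwx)) hwx
    linarith [hlow x (by linarith)]
  have hmain := h.sum_integral_one_sub_le hr hΔ hgap hα hδ (m := l w / 8) (by positivity) hαm
    hp0 hp1 T
  rw [← hn] at hmain
  have hQT : ∑ t ∈ Finset.range T, μ.real {ω | p t ω s ≤ 1 / 2}
      ≤ ∑' t, μ.real {ω | p t ω s ≤ 1 / 2} :=
    hQ.sum_le_tsum _ fun _ _ => measureReal_nonneg
  have hδT : δ⁻¹ ≤ T := by
    rw [inv_le_iff_one_le_mul₀ hδ]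
    have e : (T : ℝ) * δ = n * C / 10 / Δ := by rw [hδdef, hw]; field_simp; norm_num
    rw [e, le_div_iff₀ hΔ]
    nlinarith
  have hlog : Real.log (1 + δ⁻¹) ≤ 2 * Real.log T :=
    (Real.log_le_log (by positivity) (by linarith)).trans (log_one_add_natCast_le hT2)
  have hlog0 : 0 ≤ Real.log (1 + δ⁻¹) := Real.log_nonneg (by linarith [inv_pos.2 hδ])
  have hlogT : 0.6 ≤ Real.log T :=
    (by linarith [Real.log_two_gt_d9] : 0.6 ≤ Real.log 2).trans (Real.log_le_log two_pos hT')
  set L := l (C / (Δ * T)) with hL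
  have hL0 : 0 < L := hslow.1 _ (by positivity)
  have hL1 : L ≤ 1 := (hrange _ (by positivity)).2
  have hLw : c * L ≤ l w := by
    have := hcl w hw0
    have e : 20 * w = C / (Δ * T) := by rw [hw]; field_simp
    rwa [e] at this
  -- Both this term and `3δT` take half of the budget `C`. Here `C = 32 / c` is exactly `2 · 8 · 2 /
  -- c`.
  have h1 : n / (Δ * (l w / 8)) * Real.log (1 + δ⁻¹) ≤ C / 2 * n / (Δ * L) * Real.log T := by
    calc n / (Δ * (l w / 8)) * Real.log (1 + δ⁻¹)
        ≤ n / (Δ * (c * L / 8)) * (2 * Real.log T) := by gcongr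
      _ = C / 2 * n / (Δ * L) * Real.log T := by rw [hCdef]; field_simp; norm_num
  have h2 : 3 * δ * T ≤ C / 2 * n / (Δ * L) * Real.log T := by
    -- The constants give `0.3 C n / Δ`, which fits because `log T ≥ log 2 > 0.6`.
    have e : 3 * δ * T = C / 2 * n / Δ * 0.6 := by rw [hδdef, hw]; field_simp; norm_num
    rw [e]
    gcongr
    exact mul_le_of_le_one_right hΔ.le hL1
  have h3 : C / 2 * n / (Δ * L) * Real.log T + C / 2 * n / (Δ * L) * Real.log T
      ≤ C * Fintype.card A / (Δ * L) * Real.log T := by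
    have e : C / 2 * n / (Δ * L) * Real.log T + C / 2 * n / (Δ * L) * Real.log T
        = C * n / (Δ * L) * Real.log T := by ring
    rw [e]
    gcongr
    linarith
  linarith
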